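/- Let $n\ge 1$ and $1\le k<n$, let $\sigma\in\mathfrak S_n$, and let $\omega=n\cdots 21$ be the maximal permutation. Let $\zeta$ be the element of maximal length of the coset $\sigma(\mathfrak S_k\times\mathfrak S_{n-k})$. Here $\sigma\mu=\sigma\circ\mu$, $s_i=(i,i+1)$ is a simple transposition, and $\ell$ denotes the length, i.e. the number of letters of a reduced (shortest) decomposition into simple transpositions. On the free module (over any commutative ring) with basis $(K_\mu)_{\mu\in\mathfrak S_n}$ let $\pi_i$ ($1\le i<n$) be the linear operator, acting on the right, with $K_\mu\pi_i=K_{\mu s_i}$ if $\mu(i)>\mu(i+1)$ and $K_\mu\pi_i=K_\mu$ otherwise, and let $\hat\pi_i=\pi_i-1$. For a reduced decomposition $w=s_{i_1}\cdots s_{i_r}$ put $\pi_w=\pi_{i_1}\cdots\pi_{i_r}$ and $\hat\pi_w=\hat\pi_{i_1}\cdots\hat\pi_{i_r}$. A transposition $\tau$ is a Bruhat transposition for $\mu$ if $\ell(\mu\tau)=\ell(\mu)+1$. Put $K_\mu\cdot\tau=K_{\mu\tau}$ if $\tau$ is a Bruhat transposition for $\mu$, and $K_\mu\cdot\tau=0$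 otherwise, extended linearly. Let $W_{\sigma,k}=(\tau_1\prec\tau_2\prec\dots\prec\tau_m)$ be the list of all Bruhat transpositions $(a,b)$ for $\sigma$ with $a\le k<b$, totally ordered by $$(a,b)\prec(a',b')\iff \sigma(a)>\sigma(a')\ \text{ or }\ \bigl(a=a'\text{ and }\sigma(b)<\sigma(b')\bigr).$$ Then, whatever reduced decompositions of $\omega\zeta$ and $\zeta^{-1}\sigma$ are used, $$K_\omega\,\hat\pi_{\omega\zeta}\,\pi_{\zeta^{-1}\sigma}=\mathfrak E_{\sigma,k},\qquad \mathfrak E_{\sigma,k}:=K_\sigma\cdot(1-\tau_1)\cdot(1-\tau_2)\cdots(1-\tau_m).$$ Call a subword $w=\tau_{j_1}\cdots\tau_{j_r}$ ($j_1<\dots<j_r$) of $W_{\sigma,k}$ valid if $\tau_{j_i}$ is a Bruhat transposition for $\sigma\tau_{j_1}\cdots\tau_{j_{i-1}}$ for every $1\le i\le r$, and write $\sigma w=\sigma\tau_{j_1}\cdots\tau_{j_r}$ and $|w|=r$. Then $$\mathfrak E_{\sigma,k}=\sum_{w\text{ valid}}(-1)^{|w|}K_{\sigma w},$$ and there is no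 cancellation in this sum: distinct valid subwords $w$ give distinct permutations $\sigma w$. Thus the coefficient of $K_\mu$ in $\mathfrak E_{\sigma,k}$ is $(-1)^{\ell(\mu)-\ell(\sigma)}=\pm1$ if $\mu=\sigma w$ for some valid subword $w$ (and then $\ell(\mu)\ge\ell(\sigma)$), and $0$ otherwise. -/

import Mathlib

namespace ZeroHecke

/-! ### The symmetric group

Permutations of `{1, …, n}` are elements of `Equiv.Perm (Fin n)` (positions and values are shifted
by one), with `(σ * μ) i = σ (μ i)`; multiplying on the right by `Equiv.swap a b` exchanges the
letters in positions `a` and `b`. -/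

/-- The simple transposition exchanging the consecutive (zero-based) positions `i` and `i + 1`. -/
def simple {n : ℕ} (i : Fin (n - 1)) : Equiv.Perm (Fin n) :=
  Equiv.swap ⟨i.val, by omega⟩ ⟨i.val + 1, by omega⟩

/-- The permutation `s_{i₁} ⋯ s_{iᵣ}` written by a word in the simple transpositions. -/
def wordProd {n : ℕ} (u : List (Fin (n - 1))) : Equiv.Perm (Fin n) :=
  (u.map simple).prod

/-- The length of a permutation: the least number of letters of a decomposition of it into simple
transpositions. -/
noncomputable def len {n : ℕ} (w : Equiv.Perm (Fin n)) : ℕ :=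
  sInf {m : ℕ | ∃ u : List (Fin (n - 1)), u.length = m ∧ wordProd u = w}

/-- `u` is a reduced decomposition of `w`. -/
def IsReducedWord {n : ℕ} (u : List (Fin (n - 1))) (w : Equiv.Perm (Fin n)) : Prop :=
  wordProd u = w ∧ u.length = len w

theorem exists_wordProd {n : ℕ} (w : Equiv.Perm (Fin n)) :
    ∃ u : List (Fin (n - 1)), wordProd u = w := by
  cases n with
  | zero => exact ⟨[], Subsingleton.elim _ _⟩
  | succ m =>
    have h : w ∈ Submonoid.closure
        (Set.range fun i : Fin m => Equiv.swap i.castSucc i.succ) := by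
      rw [Equiv.Perm.mclosure_swap_castSucc_succ]; trivial
    induction h using Submonoid.closure_induction with
    | mem x hx =>
      obtain ⟨i, rfl⟩ := hx
      exact ⟨[i], by simp only [wordProd, List.map_cons, List.map_nil, List.prod_singleton]; rfl⟩
    | one => exact ⟨[], rfl⟩
    | mul x y _ _ hx hy =>
      obtain ⟨u, rfl⟩ := hx
      obtain ⟨v, rfl⟩ := hy
      exact ⟨u ++ v, by simp [wordProd]⟩

/-- Every permutation has a reduced decomposition. -/
theorem exists_isReducedWord {n : ℕ} (w : Equiv.Perm (Fin n)) :
    ∃ u : List (Fin (n - 1)), IsReducedWord u w := by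
  obtain ⟨u, hu⟩ := exists_wordProd w
  have hne : {m : ℕ | ∃ u : List (Fin (n - 1)), u.length = m ∧ wordProd u = w}.Nonempty :=
    ⟨u.length, u, rfl, hu⟩
  obtain ⟨v, hv, hw⟩ := Nat.sInf_mem hne
  exact ⟨v, hw, hv⟩

/-- The maximal permutation `ω = n ⋯ 2 1`. -/
def omega (n : ℕ) : Equiv.Perm (Fin n) := Fin.revPerm

/-- `μ` lies in the coset `σ (𝔖_k × 𝔖_{n-k})`, where `𝔖_k × 𝔖_{n-k}` consists of the permutations
that preserve the set of the first `k` positions. -/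
def InCoset {n : ℕ} (k : ℕ) (σ μ : Equiv.Perm (Fin n)) : Prop :=
  ∃ g : Equiv.Perm (Fin n), (∀ i, (g i).val < k ↔ i.val < k) ∧ μ = σ * g

/-- `ζ` is the maximal element (the element of maximal length) of `σ (𝔖_k × 𝔖_{n-k})`. -/
def IsMaxInCoset {n : ℕ} (k : ℕ) (σ ζ : Equiv.Perm (Fin n)) : Prop :=
  InCoset k σ ζ ∧ ∀ μ, InCoset k σ μ → len μ ≤ len ζ

theorem exists_isMaxInCoset {n : ℕ} (k : ℕ) (σ : Equiv.Perm (Fin n)) :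
    ∃ ζ, IsMaxInCoset k σ ζ := by
  obtain ⟨ζ, h, h'⟩ := Set.exists_max_image {μ | InCoset k σ μ} len (Set.toFinite _)
    ⟨σ, 1, by simp, by simp⟩
  exact ⟨ζ, h, h'⟩

/-! ### Bruhat transpositions

A transposition `(a, b)` is represented by the pair of positions it exchanges. -/

/-- The product `μ τ`. -/
def mulT {n : ℕ} (μ : Equiv.Perm (Fin n)) (τ : Fin n × Fin n) : Equiv.Perm (Fin n) :=
  μ * Equiv.swap τ.1 τ.2

/-- `τ` is a Bruhat transposition for `μ`: `μ τ` covers `μ` in the Bruhat order. -/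
def IsBruhat {n : ℕ} (μ : Equiv.Perm (Fin n)) (τ : Fin n × Fin n) : Prop :=
  len (mulT μ τ) = len μ + 1

/-- `τ = (a, b)` is a `k`-transposition, `a ≤ k < b` for one-based positions, and it is a Bruhat
transposition for `σ`. -/
def IsKBruhat {n : ℕ} (k : ℕ) (σ : Equiv.Perm (Fin n)) (τ : Fin n × Fin n) : Prop :=
  τ.1.val < k ∧ k ≤ τ.2.val ∧ IsBruhat σ τ

/-- The reflexive form of the total order `≺` on transpositions attached to `σ`:
`(a, b) ≺ (a', b')` iff `σ a > σ a'`, or `a = a'` and `σ b < σ b'`. -/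
def Prec {n : ℕ} (σ : Equiv.Perm (Fin n)) (τ θ : Fin n × Fin n) : Prop :=
  σ θ.1 < σ τ.1 ∨ (τ.1 = θ.1 ∧ σ τ.2 ≤ σ θ.2)

instance {n : ℕ} (σ : Equiv.Perm (Fin n)) : DecidableRel (Prec σ) :=
  fun _ _ => inferInstanceAs (Decidable (_ ∨ _))

instance {n : ℕ} (σ : Equiv.Perm (Fin n)) : IsTrans (Fin n × Fin n) (Prec σ) where
  trans := by
    rintro ⟨a, b⟩ ⟨c, d⟩ ⟨e, f⟩ (h | ⟨h, h'⟩) (g | ⟨g, g'⟩)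
    · exact Or.inl (lt_trans g h)
    · simp only at g h; exact Or.inl (g ▸ h)
    · simp only at g h; exact Or.inl (h ▸ g)
    · exact Or.inr ⟨h.trans g, le_trans h' g'⟩

instance {n : ℕ} (σ : Equiv.Perm (Fin n)) : Std.Antisymm (Prec σ) where
  antisymm := by
    rintro ⟨a, b⟩ ⟨c, d⟩ (h | ⟨h, h'⟩) (g | ⟨g, g'⟩)
    · exact absurd h (lt_asymm g)
    · simp only at g h; subst g; exact absurd h (lt_irrefl _)
    · simp only at g h; subst h; exact absurd g (lt_irrefl _)
    · simp only at h h' g'; rw [h, σ.injective (le_antisymm h' g')]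

instance {n : ℕ} (σ : Equiv.Perm (Fin n)) : Std.Total (Prec σ) where
  total := by
    rintro ⟨a, b⟩ ⟨c, d⟩
    rcases lt_trichotomy (σ a) (σ c) with h | h | h
    · exact Or.inr (Or.inl h)
    · have h := σ.injective h
      rcases le_total (σ b) (σ d) with g | g
      · exact Or.inl (Or.inr ⟨h, g⟩)
      · exact Or.inr (Or.inr ⟨h.symm, g⟩)
    · exact Or.inl (Or.inl h)

open Classical in
/-- `W_{σ,k}`: the list of the `k`-transpositions that are Bruhat transpositions for `σ`, in
increasing order for `≺`. -/
noncomputable def W {n : ℕ} (k : ℕ) (σ : Equiv.Perm (Fin n)) : List (Fin n × Fin n) :=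
  (Finset.univ.filter (IsKBruhat k σ)).sort (Prec σ)

/-- The word `w` of transpositions is valid from `μ`: applying its letters successively on the right
of `μ` goes up by one cover of the Bruhat order at each step. -/
def IsValid {n : ℕ} : Equiv.Perm (Fin n) → List (Fin n × Fin n) → Prop
  | _, [] => True
  | μ, τ :: w => IsBruhat μ τ ∧ IsValid (mulT μ τ) w

/-- `μ w`, the permutation reached from `μ` by applying the letters of `w` successively. -/
def endpoint {n : ℕ} (μ : Equiv.Perm (Fin n)) (w : List (Fin n × Fin n)) : Equiv.Perm (Fin n) :=
  w.foldl mulT μ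

open Classical in
/-- The finite set of the subwords of `W_{σ,k}` that are valid from `σ`. -/
noncomputable def validSubwords {n : ℕ} (k : ℕ) (σ : Equiv.Perm (Fin n)) :
    Finset (List (Fin n × Fin n)) :=
  (W k σ).sublists.toFinset.filter (IsValid σ)

/-! ### Operators on the free module with basis `K`

All operators act on the right of vectors: `f.foldl` applies the letters of a word from left to
right. -/

/-- The basis vector `K_σ`. -/
noncomputable def K (R : Type*) [CommRing R] {n : ℕ} (σ : Equiv.Perm (Fin n)) :
    Equiv.Perm (Fin n) →₀ R :=
  Finsupp.single σ 1

/-- `K_σ π_i = K_{σ s_i}` if `σ_i > σ_{i+1}`, and `K_σ π_i = K_σ` otherwise. -/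
noncomputable def pi (R : Type*) [CommRing R] {n : ℕ} (i : Fin (n - 1)) :
    (Equiv.Perm (Fin n) →₀ R) →ₗ[R] (Equiv.Perm (Fin n) →₀ R) :=
  Finsupp.linearCombination R fun σ : Equiv.Perm (Fin n) =>
    if σ ⟨i.val + 1, by omega⟩ < σ ⟨i.val, by omega⟩ then K R (σ * simple i) else K R σ

/-- `π̂_i = π_i - 1`. -/
noncomputable def piHat (R : Type*) [CommRing R] {n : ℕ} (i : Fin (n - 1)) :
    (Equiv.Perm (Fin n) →₀ R) →ₗ[R] (Equiv.Perm (Fin n) →₀ R) :=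
  pi R i - LinearMap.id

/-- `x π_{i₁} ⋯ π_{iᵣ}`; this is `x π_w` when `i₁ ⋯ iᵣ` is a reduced decomposition of `w`. -/
noncomputable def piWord {R : Type*} [CommRing R] {n : ℕ} (x : Equiv.Perm (Fin n) →₀ R)
    (u : List (Fin (n - 1))) : Equiv.Perm (Fin n) →₀ R :=
  u.foldl (fun y i => pi R i y) x

/-- `x π̂_{i₁} ⋯ π̂_{iᵣ}`; this is `x π̂_w` when `i₁ ⋯ iᵣ` is a reduced decomposition of `w`. -/
noncomputable def piHatWord {R : Type*} [CommRing R] {n : ℕ} (x : Equiv.Perm (Fin n) →₀ R)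
    (u : List (Fin (n - 1))) : Equiv.Perm (Fin n) →₀ R :=
  u.foldl (fun y i => piHat R i y) x

open Classical in
/-- `K_μ · τ = K_{μ τ}` if `τ` is a Bruhat transposition for `μ`, and `K_μ · τ = 0` otherwise. -/
noncomputable def actT (R : Type*) [CommRing R] {n : ℕ} (τ : Fin n × Fin n) :
    (Equiv.Perm (Fin n) →₀ R) →ₗ[R] (Equiv.Perm (Fin n) →₀ R) :=
  Finsupp.linearCombination R fun μ : Equiv.Perm (Fin n) =>
    if IsBruhat μ τ then K R (mulT μ τ) else 0

/-- `K_σ · (1 - τ₁) · (1 - τ₂) ⋯ (1 - τₘ)` where `W_{σ,k} = (τ₁ ≺ τ₂ ≺ ⋯ ≺ τₘ)`. -/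
noncomputable def E (R : Type*) [CommRing R] {n : ℕ} (k : ℕ) (σ : Equiv.Perm (Fin n)) :
    Equiv.Perm (Fin n) →₀ R :=
  (W k σ).foldl (fun x τ => x - actT R τ x) (K R σ)

end ZeroHecke

open ZeroHecke

/-!
Write `π_i = (1 + t) d`, where `t` is the operator of the transposition `τ = (i, i + 1)` and `d`
maps `K_μ` to `K_{μ τ}` if `μ` has a descent at `i` and to `0` otherwise, so that `t² = 0` and
`t d + d t = 1`. The factors `1 - (a, b)` form a Yang–Baxter family, and `d` permutes those other
than `1 - t`. Hence the product `Δ` of all of them satisfies `Δ (π_i - 1) = (1 - t) d Δ`. Since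
`(1 - t) d` maps `K_μ` to `K_{μ τ}` at a descent and `K_ω Δ = K_ω`, this gives
`K_ω π̂_{ωζ} = K_ζ Δ`. Moreover `Δ` is the product of the triangle of the first `k` positions, that
of the remaining ones and the rectangle of the `(a, b)` with `a ≤ k < b`. The triangles fix `K_ζ`,
which decreases on both blocks, and the rectangle commutes with `π_i` for `i ≠ k`, so
`K_ζ Δ π_{ζ⁻¹σ}` is `K_σ` times the rectangle. There the letters that are not Bruhat for `σ` act
trivially, and the others only need commutations to be put in the order `≺`.

Distinct valid subwords have distinct endpoints: after removing a common suffix, let `(a, b)` be the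
`≺`-larger of the last letters. It leaves a larger value in position `a` than in position `b`, and
if the subword without `(a, b)` reaches the same value in position `b`, it leaves a smaller one in
position `a`.
-/

namespace ZeroHecke

open Equiv

/-! ### Inversions and length -/

section Inversions

variable {ι : Type*} [LinearOrder ι] {μ : Perm ι} {a b : ι}

/-- The cover relation of the Bruhat order: the values of `μ` at the positions `a` and `b` increase
and no position strictly between `a` and `b` has a value strictly between theirs. -/
def IsCover (μ : Perm ι) (a b : ι) : Prop :=
  μ a < μ b ∧ ∀ r, a < r → r < b → μ r < μ a ∨ μ b < μ r

theorem isCover_iff_lt_of_covBy (h : a ⋖ b) : IsCover μ a b ↔ μ a < μ b :=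
  ⟨And.left, fun hμ => ⟨hμ, fun _ har hrb => absurd hrb (h.2 har)⟩⟩

/-- Moves an increasing pair of positions along `swap a b` when its image is still increasing; this
compares the inversions of `μ` with those of `μ * swap a b`. -/
def swapPair (a b : ι) (p : ι × ι) : ι × ι :=
  if swap a b p.1 < swap a b p.2 then (swap a b p.1, swap a b p.2) else p

theorem swapPair_swapPair (a b : ι) {p : ι × ι} (hp : p.1 < p.2) :
    swapPair a b (swapPair a b p) = p := by
  by_cases h : swap a b p.1 < swap a b p.2 <;> simp [swapPair, h, hp]

variable [Fintype ι]

/-- The set of inversions of a permutation, as pairs of positions. -/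
def invSet (μ : Perm ι) : Finset (ι × ι) :=
  Finset.univ.filter fun p => p.1 < p.2 ∧ μ p.2 < μ p.1

theorem mem_invSet {x y : ι} : (x, y) ∈ invSet μ ↔ x < y ∧ μ y < μ x := by
  simp [invSet]

/-- The number of inversions of a permutation. -/
def inv (μ : Perm ι) : ℕ := (invSet μ).card

theorem card_image_swapPair (hab : a < b) (hμ : μ a < μ b) :
    ((insert (a, b) (invSet μ)).image (swapPair a b)).card = inv μ + 1 := by
  have hlt : ∀ p ∈ insert (a, b) (invSet μ), p.1 < p.2 := by
    simp only [Finset.mem_insert, forall_eq_or_imp]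
    exact ⟨hab, fun p hp => (mem_invSet.1 hp).1⟩
  have hnot : (a, b) ∉ invSet μ := fun h => lt_asymm hμ (mem_invSet.1 h).2
  rw [Finset.card_image_of_injOn, Finset.card_insert_of_notMem hnot, inv]
  intro p hp q hq hpq
  rw [← swapPair_swapPair a b (hlt p hp), hpq, swapPair_swapPair a b (hlt q hq)]

theorem image_swapPair_subset (hab : a < b) (hμ : μ a < μ b) :
    (insert (a, b) (invSet μ)).image (swapPair a b) ⊆ invSet (μ * swap a b) := by
  rintro p hp
  obtain ⟨⟨x, y⟩, hxy, rfl⟩ := Finset.mem_image.1 hp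
  rw [Finset.mem_insert, mem_invSet] at hxy
  simp only [swapPair, invSet, Perm.mul_apply, swap_apply_def]
  grind

theorem image_swapPair_eq_iff (hab : a < b) (hμ : μ a < μ b) :
    (insert (a, b) (invSet μ)).image (swapPair a b) = invSet (μ * swap a b) ↔ IsCover μ a b := by
  constructor
  · refine fun heq => ⟨hμ, fun r har hrb => ?_⟩
    by_contra! hr
    have hμr : μ r ≠ μ b := μ.injective.ne hrb.ne
    have hmem : (a, r) ∈ invSet (μ * swap a b) := by
      rw [mem_invSet, Perm.mul_apply, Perm.mul_apply, swap_apply_left,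
        swap_apply_of_ne_of_ne har.ne' hrb.ne]
      exact ⟨har, lt_of_le_of_ne hr.2 hμr⟩
    rw [← heq, Finset.mem_image] at hmem
    obtain ⟨⟨x, y⟩, hxy, he⟩ := hmem
    rw [Finset.mem_insert, mem_invSet] at hxy
    simp only [swapPair, swap_apply_def] at he
    grind
  · refine fun hcov => (image_swapPair_subset hab hμ).antisymm ?_
    rintro ⟨x, y⟩ hxy
    rw [mem_invSet, Perm.mul_apply, Perm.mul_apply] at hxy
    refine Finset.mem_image.2 ⟨swapPair a b (x, y), ?_, swapPair_swapPair a b hxy.1⟩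
    have := hcov.2
    simp only [swapPair, Finset.mem_insert, invSet, Finset.mem_filter, Finset.mem_univ, true_and,
      swap_apply_def] at hxy ⊢
    grind

theorem inv_lt_inv_mul_swap (hab : a < b) (hμ : μ a < μ b) : inv μ < inv (μ * swap a b) := by
  rw [← Nat.add_one_le_iff, ← card_image_swapPair hab hμ]
  exact Finset.card_le_card (image_swapPair_subset hab hμ)

theorem inv_mul_swap_eq_iff (hab : a < b) :
    inv (μ * swap a b) = inv μ + 1 ↔ IsCover μ a b := by
  rcases lt_or_gt_of_ne (μ.injective.ne hab.ne) with hμ | hμ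
  · rw [← image_swapPair_eq_iff hab hμ, ← card_image_swapPair hab hμ, inv]
    exact ⟨fun h => Finset.eq_of_subset_of_card_le (image_swapPair_subset hab hμ) h.le,
      fun h => by rw [h]⟩
  · have hlt : inv (μ * swap a b) < inv (μ * swap a b * swap a b) :=
      inv_lt_inv_mul_swap hab (by simpa using hμ)
    rw [mul_assoc, swap_mul_self, mul_one] at hlt
    exact iff_of_false (by lia) fun h => lt_asymm hμ h.1

theorem inv_mul_swap_of_lt (h : a ⋖ b) (hμ : μ a < μ b) : inv (μ * swap a b) = inv μ + 1 :=
  (inv_mul_swap_eq_iff h.1).2 ((isCover_iff_lt_of_covBy h).2 hμ)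

theorem inv_mul_swap_of_gt (h : a ⋖ b) (hμ : μ b < μ a) : inv (μ * swap a b) + 1 = inv μ := by
  rw [← inv_mul_swap_of_lt h (μ := μ * swap a b) (by simpa using hμ), mul_assoc, swap_mul_self,
    mul_one]

theorem inv_one : inv (1 : Perm ι) = 0 := by
  rw [inv, Finset.card_eq_zero, Finset.eq_empty_iff_forall_notMem]
  exact fun _ h => lt_asymm (mem_invSet.1 h).1 (mem_invSet.1 h).2

end Inversions

section Length

variable {n : ℕ}

/-- The left position exchanged by the simple transposition `simple i`. -/
def lft (i : Fin (n - 1)) : Fin n := ⟨i.val, by lia⟩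

/-- The right position exchanged by the simple transposition `simple i`. -/
def rgt (i : Fin (n - 1)) : Fin n := ⟨i.val + 1, by lia⟩

theorem lft_covBy_rgt (i : Fin (n - 1)) : lft i ⋖ rgt i :=
  ⟨by simp [lft, rgt], fun c hc hc' => by
    rw [Fin.lt_def] at hc hc'; simp only [lft, rgt] at hc hc'; lia⟩

theorem simple_eq (i : Fin (n - 1)) : simple i = swap (lft i) (rgt i) := rfl

theorem simple_mul_self (i : Fin (n - 1)) : simple i * simple i = 1 := swap_mul_self _ _

theorem lt_or_gt_simple (μ : Perm (Fin n)) (i : Fin (n - 1)) :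
    μ (lft i) < μ (rgt i) ∨ μ (rgt i) < μ (lft i) :=
  lt_or_gt_of_ne (μ.injective.ne (lft_covBy_rgt i).ne)

theorem wordProd_append_singleton (u : List (Fin (n - 1))) (i : Fin (n - 1)) :
    wordProd (u ++ [i]) = wordProd u * simple i := by
  simp [wordProd]

theorem inv_wordProd_le (u : List (Fin (n - 1))) : inv (wordProd u) ≤ u.length := by
  induction u using List.reverseRecOn with
  | nil => simp [wordProd, inv_one]
  | append_singleton u i ih =>
    rw [wordProd_append_singleton, simple_eq, List.length_append, List.length_singleton]
    rcases lt_or_gt_simple (wordProd u) i with h | h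
    · rw [inv_mul_swap_of_lt (lft_covBy_rgt i) h]; lia
    · have := inv_mul_swap_of_gt (lft_covBy_rgt i) h; lia

theorem eq_one_of_forall_lt {μ : Perm (Fin n)} (h : ∀ i, μ (lft i) < μ (rgt i)) : μ = 1 := by
  have hmono : StrictMono μ := by
    cases n with
    | zero => exact fun a => a.elim0
    | succ m => exact Fin.strictMono_iff_lt_succ.2 fun i => h i
  have hid : ⇑μ = id := (hmono.range_inj strictMono_id).1 (by simp [μ.surjective.range_eq])
  exact Equiv.ext fun i => congrFun hid i

theorem exists_wordProd_length_inv (μ : Perm (Fin n)) :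
    ∃ u : List (Fin (n - 1)), u.length = inv μ ∧ wordProd u = μ := by
  induction hm : inv μ using Nat.strong_induction_on generalizing μ with
  | _ m ih =>
    by_cases h : ∀ i : Fin (n - 1), μ (lft i) < μ (rgt i)
    · obtain rfl := eq_one_of_forall_lt h
      exact ⟨[], by rw [← hm, inv_one, List.length_nil], rfl⟩
    · push Not at h
      obtain ⟨i, hi⟩ := h
      have hinv : inv (μ * simple i) + 1 = inv μ := inv_mul_swap_of_gt (lft_covBy_rgt i)
        (lt_of_le_of_ne hi (μ.injective.ne (lft_covBy_rgt i).ne'))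
      obtain ⟨u, hlen, hu⟩ := ih _ (by lia) (μ * simple i) rfl
      refine ⟨u ++ [i], ?_, ?_⟩
      · rw [List.length_append, List.length_singleton, hlen, hinv, hm]
      · rw [wordProd_append_singleton, hu, mul_assoc, simple_mul_self, mul_one]

theorem len_eq_inv (μ : Perm (Fin n)) : len μ = inv μ := by
  apply le_antisymm
  · exact Nat.sInf_le (exists_wordProd_length_inv μ)
  · obtain ⟨u, hu, hlen⟩ := exists_isReducedWord μ
    rw [← hlen]
    exact hu ▸ inv_wordProd_le u

theorem len_mul_simple_of_lt {μ : Perm (Fin n)} {i : Fin (n - 1)} (h : μ (lft i) < μ (rgt i)) :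
    len (μ * simple i) = len μ + 1 := by
  rw [len_eq_inv, len_eq_inv, simple_eq, inv_mul_swap_of_lt (lft_covBy_rgt i) h]

theorem len_mul_simple_of_gt {μ : Perm (Fin n)} {i : Fin (n - 1)} (h : μ (rgt i) < μ (lft i)) :
    len (μ * simple i) + 1 = len μ := by
  rw [len_eq_inv, len_eq_inv, simple_eq, inv_mul_swap_of_gt (lft_covBy_rgt i) h]

theorem isBruhat_iff_isCover {μ : Perm (Fin n)} {a b : Fin n} (hab : a < b) :
    IsBruhat μ (a, b) ↔ IsCover μ a b := by
  rw [IsBruhat, mulT, len_eq_inv, len_eq_inv, inv_mul_swap_eq_iff hab]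

end Length

/-! ### Covers of the Bruhat order -/

section Cover

variable {ι : Type*} [LinearOrder ι] {μ : Perm ι} {a b c d p q : ι}

theorem isCover_swap_disjoint (hab : a < b) (hcd : c < d) (hac : a ≠ c) (had : a ≠ d)
    (hbc : b ≠ c) (hbd : b ≠ d) (h1 : IsCover μ a b) (h2 : IsCover (μ * swap a b) c d) :
    IsCover μ c d ∧ IsCover (μ * swap c d) a b := by
  simp only [IsCover, Perm.mul_apply, swap_apply_def] at *
  grind [μ.injective.eq_iff]

theorem isCover_ab_bc_iff (hab : a < b) (hbc : b < c) :
    (IsCover μ a b ∧ IsCover (μ * swap a b) b c) ↔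
      (IsCover μ b c ∧ IsCover (μ * swap b c) a c) ∨
        (IsCover μ a c ∧ IsCover (μ * swap a c) a b) := by
  have := hab.trans hbc
  have hμbc := μ.injective.ne hbc.ne
  have hab_bc : IsCover (μ * swap a b) b c ↔
      μ a < μ c ∧ ∀ r, b < r → r < c → μ r < μ a ∨ μ c < μ r := by
    simp only [IsCover, Perm.mul_apply, swap_apply_def]
    grind
  have hbc_ac : IsCover (μ * swap b c) a c ↔
      μ a < μ b ∧ (μ c < μ a ∨ μ b < μ c) ∧
        ∀ r, a < r → r < c → r ≠ b → μ r < μ a ∨ μ b < μ r := by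
    simp only [IsCover, Perm.mul_apply, swap_apply_def]
    grind
  have hac_ab : IsCover (μ * swap a c) a b ↔
      μ c < μ b ∧ ∀ r, a < r → r < b → μ r < μ c ∨ μ b < μ r := by
    simp only [IsCover, Perm.mul_apply, swap_apply_def]
    grind
  rw [hab_bc, hbc_ac, hac_ab, IsCover, IsCover, IsCover]
  constructor
  · grind
  · grind

theorem isCover_toDual : IsCover (ι := ιᵒᵈ) μ b a ↔ IsCover μ a b :=
  and_congr_right fun _ => forall_congr' fun _ =>
    ⟨fun h har hrb => (h hrb har).symm, fun h hrb har => (h har hrb).symm⟩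

theorem isCover_bc_ab_iff (hab : a < b) (hbc : b < c) :
    (IsCover μ b c ∧ IsCover (μ * swap b c) a b) ↔
      (IsCover μ a b ∧ IsCover (μ * swap a b) a c) ∨
        (IsCover μ a c ∧ IsCover (μ * swap a c) b c) := by
  have h := isCover_ab_bc_iff (ι := ιᵒᵈ) (μ := μ) hbc hab
  rw [swap_comm (α := ιᵒᵈ) c b, swap_comm (α := ιᵒᵈ) b a, swap_comm (α := ιᵒᵈ) c a] at h
  have dual : ∀ (ν : Perm ι) x y, IsCover (ι := ιᵒᵈ) ν x y ↔ IsCover ν y x :=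
    fun _ _ _ => isCover_toDual
  exact (and_congr (dual _ _ _) (dual _ _ _)).symm.trans (h.trans
    (or_congr (and_congr (dual _ _ _) (dual _ _ _)) (and_congr (dual _ _ _) (dual _ _ _))))

theorem swap_lt_swap_of_covBy (hpq : p ⋖ q) (hab : a < b) (hne : (a, b) ≠ (p, q)) :
    swap p q a < swap p q b := by
  have hlt := hpq.1
  have hbetween := hpq.2
  simp only [swap_apply_def]
  grind

theorem descent_and_isCover_mul_swap_iff (hpq : p ⋖ q) (hab : a < b) (hne : (a, b) ≠ (p, q)) :
    (μ q < μ p ∧ IsCover (μ * swap p q) a b) ↔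
      IsCover μ (swap p q a) (swap p q b) ∧
        (μ * swap (swap p q a) (swap p q b)) q < (μ * swap (swap p q a) (swap p q b)) p := by
  have hlt := hpq.1
  have hbetween := hpq.2
  have hpq_ne := hpq.ne
  rw [IsCover, IsCover]
  by_cases h : a = p ∨ a = q ∨ b = p ∨ b = q
  · rcases h with rfl | rfl | rfl | rfl <;>
    · simp only [Perm.mul_apply, swap_apply_def] at *
      constructor <;> grind [μ.injective.eq_iff]
  · push Not at h
    obtain ⟨hap, haq, hbp, hbq⟩ := h
    have : a < p ∧ p < b ↔ a < q ∧ q < b := by grind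
    simp only [Perm.mul_apply, swap_apply_of_ne_of_ne, ne_eq, not_false_eq_true, *]
    simp only [swap_apply_def]
    constructor <;> grind

theorem IsCover.left_lt_left (hab : IsCover μ a b) (hcb : c < b) (hac : μ a < μ c)
    (hμ : μ c < μ b) : c < a := by
  by_contra! h
  rcases h.eq_or_lt with rfl | h
  · exact lt_irrefl _ hac
  · exact (hab.2 c h hcb).elim (lt_asymm hac) (lt_asymm hμ)

theorem IsCover.right_lt_right (hab : IsCover μ a b) (had : a < d) (hμ : μ a < μ d)
    (hdb : μ d < μ b) : b < d := by
  by_contra! h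
  rcases h.eq_or_lt with rfl | h
  · exact lt_irrefl _ hdb
  · exact (hab.2 d had h).elim (lt_asymm hμ) (lt_asymm hdb)

theorem isCover_of_isCover_mul_swap (hab : a < b) (hcd : c < d) (had : a < d) (hcb : c < b)
    (h : c < a ∨ c = a ∧ b < d) (h1 : IsCover μ c d) (h2 : IsCover (μ * swap c d) a b) :
    IsCover μ a b := by
  rcases h with hca | ⟨rfl, hbd⟩
  · rcases eq_or_ne d b with rfl | hdb
    · exact ((isCover_bc_ab_iff hca hab).2 (Or.inr ⟨h1, h2⟩)).1
    · exact (isCover_swap_disjoint hcd hab hca.ne hcb.ne had.ne' hdb h1 h2).1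
  · exact ((isCover_ab_bc_iff hab hbd).2 (Or.inr ⟨h1, h2⟩)).1

end Cover

/-! ### The operators attached to transpositions -/

section RingRelations

variable {A : Type*} [Ring A] {t d x y z : A}

theorem one_sub_mul_yangBaxter (hx : x * x = 0) (hxz : x * z = z * y + y * x)
    (hzx : z * x = x * y + y * z) :
    (1 - x) * (1 - y) * (1 - z) = (1 - z) * (1 - y) * (1 - x) := by
  have hxyz : x * y * z = x * z * x := by
    rw [mul_assoc, eq_sub_of_add_eq' hzx.symm, mul_sub, ← mul_assoc x x y, hx, zero_mul, sub_zero,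
      mul_assoc]
  have hzyx : z * y * x = x * z * x := by
    rw [eq_sub_of_add_eq hxz.symm, sub_mul, mul_assoc y x x, hx, mul_zero, sub_zero]
  calc (1 - x) * (1 - y) * (1 - z)
      = 1 - x - y - z + x * z + (x * y + y * z) - x * y * z := by noncomm_ring
    _ = 1 - x - y - z + (z * y + y * x) + z * x - z * y * x := by rw [hxz, hzx, hxyz, hzyx]
    _ = (1 - z) * (1 - y) * (1 - x) := by noncomm_ring

theorem one_sub_mul_one_add_mul_sub_one (ht : t * t = 0) (htd : t * d + d * t = 1) :
    (1 - t) * ((1 + t) * d - 1) = (1 - t) * d * (1 - t) := by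
  have hdt : d * t = 1 - t * d := eq_sub_of_add_eq' htd
  calc (1 - t) * ((1 + t) * d - 1) = d - t * t * d - 1 + t := by noncomm_ring
    _ = d - (1 - t * d) - t * d + t * (1 - t * d) := by
      rw [mul_sub, ← mul_assoc, ht]; noncomm_ring
    _ = d - d * t - t * d + t * (d * t) := by rw [hdt]
    _ = (1 - t) * d * (1 - t) := by noncomm_ring

theorem semiconjBy_one_add (ht : t * t = 0) (h : SemiconjBy (1 - t) x y) :
    SemiconjBy (1 + t) y x := by
  let u : Aˣ :=
    { val := 1 - t
      inv := 1 + t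
      val_inv := by linear_combination (norm := noncomm_ring) -ht
      inv_val := by linear_combination (norm := noncomm_ring) -ht }
  exact SemiconjBy.units_inv_symm_left (a := u) h

end RingRelations

section Operators

variable (R : Type*) [CommRing R] {n : ℕ}

/-- The ring of operators on the free module with basis `K`, multiplied in the order in which they
act on the right. -/
def Op (n : ℕ) : Type _ := (Module.End R (Perm (Fin n) →₀ R))ᵐᵒᵖ

noncomputable instance : Ring (Op R n) :=
  inferInstanceAs (Ring (Module.End R (Perm (Fin n) →₀ R))ᵐᵒᵖ)

/-- The operator `K_μ ↦ K_μ · (a, b)`. -/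
noncomputable def transOp (a b : Fin n) : Op R n := MulOpposite.op (actT R (a, b))

/-- The factor `1 - (a, b)` of the products that define `E`. -/
noncomputable def factorOp (a b : Fin n) : Op R n := 1 - transOp R a b

/-- The operator `K_μ ↦ K_{μ (p, q)}` if `μ p > μ q`, and `K_μ ↦ 0` otherwise. -/
noncomputable def descentOp (p q : Fin n) : Op R n :=
  MulOpposite.op (Finsupp.linearCombination R fun μ : Perm (Fin n) =>
    if μ q < μ p then K R (μ * swap p q) else 0)

/-- For `p ⋖ q` this is the operator `π` of the simple transposition `(p, q)`; writing it through
`transOp` and `descentOp` is what makes its commutation with the `factorOp`s visible. -/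
noncomputable def piOp (p q : Fin n) : Op R n := (1 + transOp R p q) * descentOp R p q

/-- For `p ⋖ q`, the operator `K_μ ↦ K_{μ (p, q)}` if `μ p > μ q`, and `K_μ ↦ -K_μ` otherwise; it is
what `π - 1` becomes when it is moved across `factorOp R p q`. -/
noncomputable def atomOp (p q : Fin n) : Op R n := factorOp R p q * descentOp R p q

variable {R}

/-- The right action of operators on vectors. -/
noncomputable def act (x : Perm (Fin n) →₀ R) (f : Op R n) : Perm (Fin n) →₀ R := f.unop x

section Act

variable (x : Perm (Fin n) →₀ R) (f g : Op R n)

theorem act_mul : act x (f * g) = act (act x f) g := rfl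

theorem act_one : act x (1 : Op R n) = x := rfl

theorem act_add : act x (f + g) = act x f + act x g := rfl

theorem act_sub : act x (f - g) = act x f - act x g := rfl

theorem sub_act (y : Perm (Fin n) →₀ R) : act (x - y) f = act x f - act y f := map_sub f.unop x y

theorem zero_act : act (0 : Perm (Fin n) →₀ R) f = 0 := map_zero f.unop

end Act

theorem op_ext {f g : Op R n} (h : ∀ μ, act (K R μ) f = act (K R μ) g) : f = g :=
  MulOpposite.unop_injective (Finsupp.lhom_ext' fun μ => LinearMap.ext_ring (h μ))

theorem linearCombination_K (v : Perm (Fin n) → Perm (Fin n) →₀ R) (μ : Perm (Fin n)) :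
    Finsupp.linearCombination R v (K R μ) = v μ := by
  rw [K, Finsupp.linearCombination_single, one_smul]

variable {a b c d p q : Fin n} {μ : Perm (Fin n)}

theorem act_K_descentOp :
    act (K R μ) (descentOp R p q) = if μ q < μ p then K R (μ * swap p q) else 0 :=
  linearCombination_K _ μ

open Classical in
theorem act_K_transOp (hab : a < b) :
    act (K R μ) (transOp R a b) = if IsCover μ a b then K R (μ * swap a b) else 0 := by
  simp only [← isBruhat_iff_isCover hab]
  exact linearCombination_K _ μ

open Classical in
theorem act_K_transOp_transOp (hab : a < b) (hcd : c < d) :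
    act (K R μ) (transOp R a b * transOp R c d) =
      if IsCover μ a b ∧ IsCover (μ * swap a b) c d then K R (μ * (swap a b * swap c d))
      else 0 := by
  rw [act_mul, act_K_transOp hab, ite_and, ← mul_assoc]
  split_ifs with h
  · rw [act_K_transOp hcd, if_pos ‹_›]
  · rw [act_K_transOp hcd, if_neg ‹_›]
  · exact zero_act _

theorem transOp_mul_self (hab : a < b) : transOp R a b * transOp R a b = 0 := by
  classical
  refine op_ext fun μ => ?_
  rw [act_K_transOp_transOp hab hab, if_neg]
  · rfl
  · rintro ⟨h1, h2⟩
    exact lt_asymm h1.1 (by simpa using h2.1)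

theorem transOp_mul_transOp_of_disjoint (hab : a < b) (hcd : c < d) (hac : a ≠ c) (had : a ≠ d)
    (hbc : b ≠ c) (hbd : b ≠ d) : Commute (transOp R a b) (transOp R c d) := by
  classical
  refine op_ext fun μ => ?_
  have hcover : IsCover μ a b ∧ IsCover (μ * swap a b) c d ↔
      IsCover μ c d ∧ IsCover (μ * swap c d) a b :=
    ⟨fun h => isCover_swap_disjoint hab hcd hac had hbc hbd h.1 h.2, fun h =>
      isCover_swap_disjoint hcd hab hac.symm hbc.symm had.symm hbd.symm h.1 h.2⟩
  have hswap : swap a b * swap c d = swap c d * swap a b := by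
    rw [swap_mul_eq_mul_swap, swap_inv, swap_apply_of_ne_of_ne hac had,
      swap_apply_of_ne_of_ne hbc hbd]
  rw [act_K_transOp_transOp hab hcd, act_K_transOp_transOp hcd hab, hswap]
  exact if_congr hcover rfl rfl

theorem ite_eq_ite_add_ite {M : Type*} [AddZeroClass M] {P Q S : Prop} [Decidable P] [Decidable Q]
    [Decidable S] (x : M) (h : P ↔ Q ∨ S) (hQS : Q → ¬S) :
    (if P then x else 0) = (if Q then x else 0) + if S then x else 0 := by
  by_cases hQ : Q
  · rw [if_pos (h.2 (Or.inl hQ)), if_pos hQ, if_neg (hQS hQ), add_zero]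
  · rw [if_neg hQ, zero_add]
    exact if_congr (h.trans (or_iff_right hQ)) rfl rfl

theorem transOp_ab_mul_transOp_bc (hab : a < b) (hbc : b < c) :
    transOp R a b * transOp R b c =
      transOp R b c * transOp R a c + transOp R a c * transOp R a b := by
  classical
  have hac := hab.trans hbc
  refine op_ext fun μ => ?_
  have hbc_ac : swap b c * swap a c = swap a b * swap b c := by
    rw [mul_swap_eq_swap_mul, swap_apply_of_ne_of_ne hab.ne hac.ne, swap_apply_right]
  have hac_ab : swap a c * swap a b = swap a b * swap b c := by
    rw [mul_swap_eq_swap_mul, swap_apply_left, swap_apply_of_ne_of_ne hab.ne' hbc.ne, swap_comm c b,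
      hbc_ac]
  rw [act_add, act_K_transOp_transOp hab hbc, act_K_transOp_transOp hbc hac,
    act_K_transOp_transOp hac hab, hbc_ac, hac_ab]
  refine ite_eq_ite_add_ite _ (isCover_ab_bc_iff hab hbc) fun h h' => lt_asymm h.1.1 ?_
  simpa [swap_apply_of_ne_of_ne hab.ne' hbc.ne] using h'.2.1

theorem transOp_bc_mul_transOp_ab (hab : a < b) (hbc : b < c) :
    transOp R b c * transOp R a b =
      transOp R a b * transOp R a c + transOp R a c * transOp R b c := by
  classical
  have hac := hab.trans hbc
  refine op_ext fun μ => ?_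
  have hab_ac : swap a b * swap a c = swap b c * swap a b := by
    rw [mul_swap_eq_swap_mul, swap_apply_left, swap_apply_of_ne_of_ne hac.ne' hbc.ne']
  have hac_bc : swap a c * swap b c = swap b c * swap a b := by
    rw [mul_swap_eq_swap_mul, swap_apply_of_ne_of_ne hab.ne' hbc.ne, swap_apply_right,
      swap_comm b a, hab_ac]
  rw [act_add, act_K_transOp_transOp hbc hab, act_K_transOp_transOp hab hac,
    act_K_transOp_transOp hac hbc, hab_ac, hac_bc]
  refine ite_eq_ite_add_ite _ (isCover_bc_ab_iff hab hbc) fun h h' => lt_asymm h.1.1 ?_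
  simpa [swap_apply_of_ne_of_ne hab.ne' hbc.ne] using h'.2.1

theorem transOp_mul_descentOp_add (hpq : p ⋖ q) :
    transOp R p q * descentOp R p q + descentOp R p q * transOp R p q = 1 := by
  classical
  refine op_ext fun μ => ?_
  rw [act_add, act_mul, act_mul, act_K_transOp hpq.1, act_K_descentOp, act_one]
  simp only [isCover_iff_lt_of_covBy hpq]
  rcases lt_or_gt_of_ne (μ.injective.ne hpq.ne) with h | h
  · rw [if_pos h, if_neg h.not_gt, zero_act, act_K_descentOp, if_pos (by simpa using h), mul_assoc,
      swap_mul_self, mul_one, add_zero]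
  · rw [if_pos h, if_neg h.not_gt, zero_act, act_K_transOp hpq.1, isCover_iff_lt_of_covBy hpq,
      if_pos (by simpa using h), mul_assoc, swap_mul_self, mul_one, zero_add]

theorem semiconjBy_descentOp_transOp (hpq : p ⋖ q) (hab : a < b) (hne : (a, b) ≠ (p, q)) :
    SemiconjBy (descentOp R p q) (transOp R a b) (transOp R (swap p q a) (swap p q b)) := by
  classical
  refine op_ext fun μ => ?_
  have hcover := descent_and_isCover_mul_swap_iff (μ := μ) hpq hab hne
  rw [act_mul, act_mul, act_K_descentOp, act_K_transOp (swap_lt_swap_of_covBy hpq hab hne)]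
  trans if μ q < μ p ∧ IsCover (μ * swap p q) a b then K R (μ * swap p q * swap a b) else 0
  · rw [ite_and]
    split_ifs with h
    · rw [act_K_transOp hab, if_pos ‹_›]
    · rw [act_K_transOp hab, if_neg ‹_›]
    · exact zero_act _
  · rw [mul_assoc, mul_swap_eq_swap_mul (swap p q), ← mul_assoc, if_congr hcover rfl rfl, ite_and]
    split_ifs with h
    · rw [act_K_descentOp, if_pos ‹_›]
    · rw [act_K_descentOp, if_neg ‹_›]
    · exact (zero_act _).symm

end Operators

/-! ### Products of a Yang–Baxter family -/

section YangBaxter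

theorem semiconjBy_list_prod_map {M κ : Type*} [Monoid M] {f g : κ → M} {x : M} {l : List κ}
    (h : ∀ i ∈ l, SemiconjBy x (f i) (g i)) : SemiconjBy x (l.map f).prod (l.map g).prod := by
  induction l with
  | nil => exact SemiconjBy.one_right x
  | cons i l ih =>
    rw [List.map_cons, List.map_cons, List.prod_cons, List.prod_cons]
    exact (h i List.mem_cons_self).mul_right (ih fun j hj => h j (List.mem_cons_of_mem i hj))

variable {ι M : Type*} [Monoid M]

/-- The product of the `r a b`, for `b` running through `l`. -/
def rowProd (r : ι → ι → M) (a : ι) (l : List ι) : M := (l.map (r a)).prod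

/-- The product of the `r a b`, for `a` before `b` in `l`, row by row. -/
def triangleProd (r : ι → ι → M) : List ι → M
  | [] => 1
  | a :: l => rowProd r a l * triangleProd r l

/-- The product of the `r a b`, for `a` in `S` and `b` in `T`, row by row. -/
def rectProd (r : ι → ι → M) (S T : List ι) : M := ((S ×ˢ T).map fun p => r p.1 p.2).prod

variable {r : ι → ι → M} {a b c p q : ι} {l S T : List ι} {x : M}

theorem rowProd_nil : rowProd r a [] = 1 := rfl

theorem rowProd_cons : rowProd r a (b :: l) = r a b * rowProd r a l := List.prod_cons

theorem rowProd_append : rowProd r a (S ++ T) = rowProd r a S * rowProd r a T := by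
  rw [rowProd, List.map_append, List.prod_append, rowProd, rowProd]

theorem triangleProd_cons : triangleProd r (a :: l) = rowProd r a l * triangleProd r l := rfl

theorem rectProd_nil : rectProd r [] T = 1 := rfl

theorem rectProd_cons : rectProd r (a :: S) T = rowProd r a T * rectProd r S T := by
  rw [rectProd, List.product_cons, List.map_append, List.prod_append, List.map_map]
  rfl

theorem commute_rowProd (h : ∀ b ∈ l, Commute x (r a b)) : Commute x (rowProd r a l) :=
  Commute.list_prod_right _ _ (by simpa only [List.forall_mem_map] using h)

theorem commute_triangleProd (h : l.Pairwise fun a b => Commute x (r a b)) :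
    Commute x (triangleProd r l) := by
  induction l with
  | nil => exact Commute.one_right x
  | cons a l ih =>
    rw [List.pairwise_cons] at h
    exact (commute_rowProd h.1).mul_right (ih h.2)

theorem rectProd_append {S' : List ι} :
    rectProd r (S ++ S') T = rectProd r S T * rectProd r S' T := by
  induction S with
  | nil => exact (one_mul _).symm
  | cons a S ih => rw [List.cons_append, rectProd_cons, rectProd_cons, ih, mul_assoc]

theorem commute_rectProd_of_rowProd (h : ∀ a ∈ S, Commute x (rowProd r a T)) :
    Commute x (rectProd r S T) := by
  induction S with
  | nil => exact Commute.one_right x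
  | cons a S ih =>
    rw [List.forall_mem_cons] at h
    rw [rectProd_cons]
    exact h.1.mul_right (ih h.2)

theorem commute_rectProd (h : ∀ a ∈ S, ∀ b ∈ T, Commute x (r a b)) :
    Commute x (rectProd r S T) :=
  commute_rectProd_of_rowProd fun a ha => commute_rowProd (h a ha)

variable [LinearOrder ι]

/-- A family of monoid elements indexed by the positive roots `a < b` of type `A` that satisfies the
Yang–Baxter equation, factors with disjoint indices being required to commute. -/
structure IsYangBaxter (r : ι → ι → M) : Prop where
  commute {a b c d : ι} (hab : a < b) (hcd : c < d) (hac : a ≠ c) (had : a ≠ d) (hbc : b ≠ c)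
    (hbd : b ≠ d) : Commute (r a b) (r c d)
  braid {a b c : ι} (hab : a < b) (hbc : b < c) :
    r a b * r a c * r b c = r b c * r a c * r a b

namespace IsYangBaxter

theorem rowProd_mul_rowProd (hr : IsYangBaxter r) (hab : a ≠ b) (ha : ∀ c ∈ T, a < c)
    (hb : ∀ c ∈ T, b < c) (hT : T.Nodup) :
    rowProd r a T * rowProd r b T = (T.map fun c => r a c * r b c).prod := by
  induction T with
  | nil => exact mul_one 1
  | cons c T ih =>
    rw [List.forall_mem_cons] at ha hb
    rw [List.nodup_cons] at hT
    have hcomm : Commute (r b c) (rowProd r a T) := commute_rowProd fun d hd =>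
      hr.commute hb.1 (ha.2 d hd) hab.symm (hb.2 d hd).ne ha.1.ne'
        (ne_of_mem_of_not_mem hd hT.1).symm
    rw [List.map_cons, List.prod_cons, ← ih ha.2 hb.2 hT.2, rowProd_cons, rowProd_cons, mul_assoc,
      ← mul_assoc (rowProd r a T), ← hcomm.eq, mul_assoc (r b c), mul_assoc (r a c)]

theorem semiconjBy_rowProd_mul_rowProd (hr : IsYangBaxter r) (hab : a < b) (hb : ∀ c ∈ T, b < c)
    (hT : T.Nodup) :
    SemiconjBy (r a b) (rowProd r a T * rowProd r b T) (rowProd r b T * rowProd r a T) := by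
  have ha : ∀ c ∈ T, a < c := fun c hc => hab.trans (hb c hc)
  rw [hr.rowProd_mul_rowProd hab.ne ha hb hT, hr.rowProd_mul_rowProd hab.ne' hb ha hT]
  refine semiconjBy_list_prod_map fun c hc => ?_
  rw [SemiconjBy, ← mul_assoc, hr.braid hab (hb c hc)]

theorem rowProd_mul_triangleProd (hr : IsYangBaxter r) (haT : (a :: T).Pairwise (· < ·)) :
    rowProd r a T * triangleProd r T = triangleProd r T * rowProd r a T.reverse := by
  induction T with
  | nil => rfl
  | cons c T ih =>
    obtain ⟨ha, hcT⟩ := List.pairwise_cons.1 haT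
    obtain ⟨hc, hT⟩ := List.pairwise_cons.1 hcT
    rw [List.forall_mem_cons] at ha
    have hbraid := hr.semiconjBy_rowProd_mul_rowProd ha.1 hc hT.nodup
    have hcomm : Commute (r a c) (triangleProd r T) := commute_triangleProd <|
      hT.imp_of_mem fun hd he hde => hr.commute ha.1 hde (ha.2 _ hd).ne (ha.2 _ he).ne
        (hc _ hd).ne (hc _ he).ne
    calc rowProd r a (c :: T) * triangleProd r (c :: T)
        = r a c * (rowProd r a T * rowProd r c T) * triangleProd r T := by
          rw [rowProd_cons, triangleProd_cons]; simp only [mul_assoc]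
      _ = rowProd r c T * (rowProd r a T * triangleProd r T) * r a c := by
          rw [hbraid.eq]; simp only [mul_assoc]; rw [hcomm.eq]
      _ = triangleProd r (c :: T) * rowProd r a (c :: T).reverse := by
          rw [ih (List.pairwise_cons.2 ⟨ha.2, hT⟩), triangleProd_cons, List.reverse_cons,
            rowProd_append, rowProd_cons, rowProd_nil, mul_one]
          simp only [mul_assoc]

theorem triangleProd_append (hr : IsYangBaxter r) (hST : (S ++ T).Pairwise (· < ·)) :
    triangleProd r (S ++ T) = triangleProd r S * triangleProd r T * rectProd r S T.reverse := by
  induction S with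
  | nil => rw [rectProd_nil, mul_one]; exact (one_mul _).symm
  | cons a S ih =>
    rw [List.cons_append, List.pairwise_cons] at hST
    obtain ⟨ha, hST⟩ := hST
    obtain ⟨hS, hT, hlt⟩ := List.pairwise_append.1 hST
    have haS : ∀ b ∈ S, a < b := fun b hb => ha b (List.mem_append_left T hb)
    have haT : ∀ b ∈ T, a < b := fun b hb => ha b (List.mem_append_right S hb)
    have hcomm : Commute (triangleProd r S) (rowProd r a T) := commute_rowProd fun t ht =>
      (commute_triangleProd <| hS.imp_of_mem fun hc hd hcd =>
        hr.commute (haT t ht) hcd (haS _ hc).ne (haS _ hd).ne (hlt _ hc t ht).ne'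
          (hlt _ hd t ht).ne').symm
    have hrow := hr.rowProd_mul_triangleProd (List.pairwise_cons.2 ⟨haT, hT⟩)
    calc triangleProd r (a :: S ++ T)
        = rowProd r a S * (rowProd r a T * triangleProd r S) * triangleProd r T *
            rectProd r S T.reverse := by
          rw [List.cons_append, triangleProd_cons, ih hST, rowProd_append]; simp only [mul_assoc]
      _ = rowProd r a S * triangleProd r S * (rowProd r a T * triangleProd r T) *
            rectProd r S T.reverse := by
          rw [← hcomm.eq]; simp only [mul_assoc]
      _ = triangleProd r (a :: S) * triangleProd r T * rectProd r (a :: S) T.reverse := by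
          rw [hrow, triangleProd_cons, rectProd_cons]; simp only [mul_assoc]

end IsYangBaxter

end YangBaxter

/-! ### Moving `π` across products of factors -/

section Factors

theorem exists_eq_append_cons_cons_of_covBy {ι : Type*} [LinearOrder ι] {l : List ι} {p q : ι}
    (hl : l.Pairwise (· < ·)) (hpq : p ⋖ q) (hp : p ∈ l) (hq : q ∈ l) :
    ∃ l₁ l₂, l = l₁ ++ p :: q :: l₂ := by
  obtain ⟨l₁, l', rfl⟩ := List.append_of_mem hp
  obtain ⟨-, hl', hlt⟩ := List.pairwise_append.1 hl
  have hq' : q ∈ l' := by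
    rcases List.mem_append.1 hq with hq | hq
    · exact absurd hpq.1 (hlt q hq p List.mem_cons_self).not_gt
    · exact (List.mem_cons.1 hq).resolve_left hpq.ne'
  obtain _ | ⟨c, l₂⟩ := l'
  · exact absurd hq' List.not_mem_nil
  obtain ⟨hp', hc⟩ := List.pairwise_cons.1 hl'
  rcases List.mem_cons.1 hq' with rfl | hq'
  · exact ⟨l₁, l₂, rfl⟩
  · exact absurd (List.rel_of_pairwise_cons hc hq') (hpq.2 (hp' c List.mem_cons_self))

variable {R : Type*} [CommRing R] {n : ℕ} {a b c d p q : Fin n}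

theorem commute_transOp_factorOp (hab : a < b) (hcd : c < d) (hac : a ≠ c) (had : a ≠ d)
    (hbc : b ≠ c) (hbd : b ≠ d) : Commute (transOp R a b) (factorOp R c d) :=
  (Commute.one_right _).sub_right (transOp_mul_transOp_of_disjoint hab hcd hac had hbc hbd)

theorem isYangBaxter_factorOp : IsYangBaxter (factorOp R (n := n)) where
  commute hab hcd hac had hbc hbd :=
    (Commute.one_left _).sub_left (commute_transOp_factorOp hab hcd hac had hbc hbd)
  braid hab hbc := one_sub_mul_yangBaxter (transOp_mul_self hab)
    (transOp_ab_mul_transOp_bc hab hbc) (transOp_bc_mul_transOp_ab hab hbc)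

theorem semiconjBy_descentOp_factorOp (hpq : p ⋖ q) (hab : a < b) (hne : (a, b) ≠ (p, q)) :
    SemiconjBy (descentOp R p q) (factorOp R a b) (factorOp R (swap p q a) (swap p q b)) :=
  (SemiconjBy.one_right _).sub_right (semiconjBy_descentOp_transOp hpq hab hne)

theorem commute_descentOp_factorOp (hpq : p ⋖ q) (hab : a < b) (hpa : p ≠ a) (hpb : p ≠ b)
    (hqa : q ≠ a) (hqb : q ≠ b) : Commute (descentOp R p q) (factorOp R a b) := by
  have h := semiconjBy_descentOp_factorOp (R := R) hpq hab fun h => hpa (Prod.ext_iff.1 h).1.symm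
  rwa [swap_apply_of_ne_of_ne hpa.symm hqa.symm, swap_apply_of_ne_of_ne hpb.symm hqb.symm] at h

theorem commute_piOp_factorOp (hpq : p ⋖ q) (hab : a < b) (hpa : p ≠ a) (hpb : p ≠ b)
    (hqa : q ≠ a) (hqb : q ≠ b) : Commute (piOp R p q) (factorOp R a b) :=
  ((Commute.one_left _).add_left (commute_transOp_factorOp hpq.1 hab hpa hpb hqa hqb)).mul_left
    (commute_descentOp_factorOp hpq hab hpa hpb hqa hqb)

theorem commute_atomOp_factorOp (hpq : p ⋖ q) (hab : a < b) (hpa : p ≠ a) (hpb : p ≠ b)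
    (hqa : q ≠ a) (hqb : q ≠ b) : Commute (atomOp R p q) (factorOp R a b) :=
  (isYangBaxter_factorOp.commute hpq.1 hab hpa hpb hqa hqb).mul_left
    (commute_descentOp_factorOp hpq hab hpa hpb hqa hqb)

theorem semiconjBy_descentOp_factorOp_of_lt (hpq : p ⋖ q) (hap : a < p) :
    SemiconjBy (descentOp R p q) (factorOp R a p) (factorOp R a q) ∧
      SemiconjBy (descentOp R p q) (factorOp R a q) (factorOp R a p) := by
  have haq := hap.trans hpq.1
  have hne : ∀ b, (a, b) ≠ (p, q) := fun b h => hap.ne (Prod.ext_iff.1 h).1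
  have hp := semiconjBy_descentOp_factorOp (R := R) hpq hap (hne p)
  have hq := semiconjBy_descentOp_factorOp (R := R) hpq haq (hne q)
  rw [swap_apply_of_ne_of_ne hap.ne haq.ne] at hp hq
  rw [swap_apply_left] at hp
  rw [swap_apply_right] at hq
  exact ⟨hp, hq⟩

theorem semiconjBy_descentOp_factorOp_of_gt (hpq : p ⋖ q) (hqc : q < c) :
    SemiconjBy (descentOp R p q) (factorOp R p c) (factorOp R q c) ∧
      SemiconjBy (descentOp R p q) (factorOp R q c) (factorOp R p c) := by
  have hpc := hpq.1.trans hqc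
  have hne : ∀ b, (b, c) ≠ (p, q) := fun b h => hqc.ne' (Prod.ext_iff.1 h).2
  have hp := semiconjBy_descentOp_factorOp (R := R) hpq hpc (hne p)
  have hq := semiconjBy_descentOp_factorOp (R := R) hpq hqc (hne q)
  rw [swap_apply_of_ne_of_ne hpc.ne' hqc.ne'] at hp hq
  rw [swap_apply_left] at hp
  rw [swap_apply_right] at hq
  exact ⟨hp, hq⟩

theorem semiconjBy_factorOp_mul_of_lt (hpq : p < q) (hap : a < p) :
    SemiconjBy (factorOp R p q) (factorOp R a q * factorOp R a p)
      (factorOp R a p * factorOp R a q) := by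
  rw [SemiconjBy, ← mul_assoc]
  exact (isYangBaxter_factorOp.braid hap hpq).symm

theorem semiconjBy_factorOp_mul_of_gt (hpq : p < q) (hqc : q < c) :
    SemiconjBy (factorOp R p q) (factorOp R p c * factorOp R q c)
      (factorOp R q c * factorOp R p c) := by
  rw [SemiconjBy, ← mul_assoc]
  exact isYangBaxter_factorOp.braid hpq hqc

theorem commute_piOp_mul_of_lt (hpq : p ⋖ q) (hap : a < p) :
    Commute (piOp R p q) (factorOp R a q * factorOp R a p) :=
  have ⟨hp, hq⟩ := semiconjBy_descentOp_factorOp_of_lt hpq hap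
  (semiconjBy_one_add (transOp_mul_self hpq.1)
    (semiconjBy_factorOp_mul_of_lt hpq.1 hap)).mul_left (hq.mul_right hp)

theorem commute_piOp_mul_of_gt (hpq : p ⋖ q) (hqc : q < c) :
    Commute (piOp R p q) (factorOp R p c * factorOp R q c) :=
  have ⟨hp, hq⟩ := semiconjBy_descentOp_factorOp_of_gt hpq hqc
  (semiconjBy_one_add (transOp_mul_self hpq.1)
    (semiconjBy_factorOp_mul_of_gt hpq.1 hqc)).mul_left (hp.mul_right hq)

theorem commute_atomOp_mul_of_lt (hpq : p ⋖ q) (hap : a < p) :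
    Commute (atomOp R p q) (factorOp R a p * factorOp R a q) :=
  have ⟨hp, hq⟩ := semiconjBy_descentOp_factorOp_of_lt hpq hap
  (semiconjBy_factorOp_mul_of_lt hpq.1 hap).mul_left (hp.mul_right hq)

theorem semiconjBy_factorOp_piOp_sub_one (hpq : p ⋖ q) :
    SemiconjBy (factorOp R p q) (piOp R p q - 1) (atomOp R p q) :=
  one_sub_mul_one_add_mul_sub_one (transOp_mul_self hpq.1) (transOp_mul_descentOp_add hpq)

variable {l l₁ l₂ S T : List (Fin n)}

theorem commute_piOp_rowProd_mul_rowProd (hpq : p ⋖ q) (hl : ∀ c ∈ l, q < c) (hnd : l.Nodup) :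
    Commute (piOp R p q) (rowProd (factorOp R) p l * rowProd (factorOp R) q l) := by
  rw [isYangBaxter_factorOp.rowProd_mul_rowProd hpq.ne (fun c hc => hpq.1.trans (hl c hc)) hl hnd]
  refine Commute.list_prod_right _ _ ?_
  rw [List.forall_mem_map]
  exact fun c hc => commute_piOp_mul_of_gt hpq (hl c hc)

theorem semiconjBy_triangleProd_piOp_sub_one (hpq : p ⋖ q)
    (hl : (l₁ ++ p :: q :: l₂).Pairwise (· < ·)) :
    SemiconjBy (triangleProd (factorOp R) (l₁ ++ p :: q :: l₂)) (piOp R p q - 1)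
      (atomOp R p q) := by
  induction l₁ with
  | nil =>
    obtain ⟨-, hq, hl₂⟩ := by simpa only [List.nil_append, List.pairwise_cons] using hl
    have hrows := commute_piOp_rowProd_mul_rowProd (R := R) hpq hq hl₂.nodup
    have htri : Commute (piOp R p q) (triangleProd (factorOp R) l₂) :=
      commute_triangleProd <| hl₂.imp_of_mem fun ha hb hab =>
        commute_piOp_factorOp hpq hab (hpq.1.trans (hq _ ha)).ne (hpq.1.trans (hq _ hb)).ne
          (hq _ ha).ne (hq _ hb).ne
    rw [List.nil_append, triangleProd_cons, triangleProd_cons, rowProd_cons,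
      mul_assoc (factorOp R p q), ← mul_assoc (rowProd _ p l₂)]
    exact (semiconjBy_factorOp_piOp_sub_one hpq).mul_left
      ((hrows.mul_right htri).symm.sub_right (Commute.one_right _))
  | cons a l₁ ih =>
    obtain ⟨ha, hl⟩ := List.pairwise_cons.1 hl
    obtain ⟨-, hpql₂, hlt⟩ := List.pairwise_append.1 hl
    have hq := (List.pairwise_cons.1 (List.pairwise_cons.1 hpql₂).2).1
    have hap : a < p := ha p (by simp)
    have hrow₁ : Commute (atomOp R p q) (rowProd (factorOp R) a l₁) :=
      commute_rowProd fun b hb => commute_atomOp_factorOp hpq (ha b (by simp [hb])) hap.ne'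
        (hlt b hb p (by simp)).ne' (hap.trans hpq.1).ne' (hlt b hb q (by simp)).ne'
    have hrow₂ : Commute (atomOp R p q) (rowProd (factorOp R) a l₂) :=
      commute_rowProd fun b hb => commute_atomOp_factorOp hpq (ha b (by simp [hb])) hap.ne'
        (hpq.1.trans (hq b hb)).ne (hap.trans hpq.1).ne' (hq b hb).ne
    rw [List.cons_append, triangleProd_cons, rowProd_append, rowProd_cons, rowProd_cons,
      ← mul_assoc (factorOp R a p)]
    have hrow := hrow₁.mul_right ((commute_atomOp_mul_of_lt hpq hap).mul_right hrow₂)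
    exact SemiconjBy.mul_left hrow.symm (ih hl)

theorem commute_piOp_rectProd_left (hpq : p ⋖ q) (hS : (l₁ ++ p :: q :: l₂).Nodup)
    (hT : T.Nodup) (hST : ∀ a ∈ l₁ ++ p :: q :: l₂, ∀ b ∈ T, a < b) :
    Commute (piOp R p q) (rectProd (factorOp R) (l₁ ++ p :: q :: l₂) T) := by
  obtain ⟨-, hnd, hdisj⟩ := List.nodup_append'.1 hS
  simp only [List.nodup_cons, List.mem_cons, not_or] at hnd
  have hp : ∀ b ∈ T, p < b := hST p (by simp)
  have hq : ∀ b ∈ T, q < b := hST q (by simp)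
  have hother : ∀ l ⊆ l₁ ++ p :: q :: l₂, p ∉ l → q ∉ l →
      Commute (piOp R p q) (rectProd (factorOp R) l T) := fun l hl hpl hql =>
    commute_rectProd fun a ha b hb => commute_piOp_factorOp hpq (hST a (hl ha) b hb)
      (ne_of_mem_of_not_mem ha hpl).symm (hp b hb).ne (ne_of_mem_of_not_mem ha hql).symm
      (hq b hb).ne
  rw [rectProd_append, rectProd_cons, rectProd_cons, ← mul_assoc (rowProd _ p T)]
  exact (hother l₁ (by simp) (fun h => hdisj h (by simp)) fun h => hdisj h (by simp)).mul_right
    ((commute_piOp_rowProd_mul_rowProd hpq hq hT).mul_right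
      (hother l₂ (fun x hx => by simp [hx]) hnd.1.2 hnd.2.1))

theorem commute_piOp_rectProd_right (hpq : p ⋖ q) (hT : (l₁ ++ q :: p :: l₂).Nodup)
    (hST : ∀ a ∈ S, ∀ b ∈ l₁ ++ q :: p :: l₂, a < b) :
    Commute (piOp R p q) (rectProd (factorOp R) S (l₁ ++ q :: p :: l₂)) := by
  obtain ⟨-, hnd, hdisj⟩ := List.nodup_append'.1 hT
  simp only [List.nodup_cons, List.mem_cons, not_or] at hnd
  refine commute_rectProd_of_rowProd fun a ha => ?_
  have hap : a < p := hST a ha p (by simp)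
  have haq : a < q := hST a ha q (by simp)
  have hother : ∀ l ⊆ l₁ ++ q :: p :: l₂, p ∉ l → q ∉ l →
      Commute (piOp R p q) (rowProd (factorOp R) a l) := fun l hl hpl hql =>
    commute_rowProd fun b hb => commute_piOp_factorOp hpq (hST a ha b (hl hb)) hap.ne'
      (ne_of_mem_of_not_mem hb hpl).symm haq.ne' (ne_of_mem_of_not_mem hb hql).symm
  rw [rowProd_append, rowProd_cons, rowProd_cons, ← mul_assoc (factorOp R a q)]
  exact (hother l₁ (by simp) (fun h => hdisj h (by simp)) fun h => hdisj h (by simp)).mul_right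
    ((commute_piOp_mul_of_lt hpq hap).mul_right
      (hother l₂ (fun x hx => by simp [hx]) hnd.2.1 hnd.1.2))

end Factors

/-! ### Reduced words of block permutations -/

section Words

variable {n k : ℕ}

/-- The subgroup `𝔖_k × 𝔖_{n-k}` of the permutations that preserve the first `k` positions. -/
def blockSubgroup (n k : ℕ) : Subgroup (Perm (Fin n)) where
  carrier := {g | ∀ i, (g i).val < k ↔ i.val < k}
  one_mem' _ := Iff.rfl
  mul_mem' {g h} hg hh i := (hg (h i)).trans (hh i)
  inv_mem' {g} hg i := by simpa using (hg (g⁻¹ i)).symm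

theorem mem_blockSubgroup {g : Perm (Fin n)} :
    g ∈ blockSubgroup n k ↔ ∀ i, (g i).val < k ↔ i.val < k :=
  Iff.rfl

theorem simple_mem_blockSubgroup {i : Fin (n - 1)} (hi : i.val + 1 ≠ k) :
    simple i ∈ blockSubgroup n k := fun j => by
  rw [simple_eq, swap_apply_def]
  split_ifs with h₁ h₂
  · rw [h₁]; simp only [lft, rgt]; lia
  · rw [h₂]; simp only [lft, rgt]; lia
  · rfl

/-- `μ` decreases on the first `k` positions and on the remaining ones. -/
def DecOnBlocks (k : ℕ) (μ : Perm (Fin n)) : Prop :=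
  ∀ ⦃a b : Fin n⦄, a < b → (a.val < k ↔ b.val < k) → μ b < μ a

theorem decOnBlocks_of_forall_simple {μ : Perm (Fin n)}
    (h : ∀ i : Fin (n - 1), i.val + 1 ≠ k → μ (rgt i) < μ (lft i)) : DecOnBlocks k μ := by
  intro a ⟨b, hb⟩ hab hk
  induction b with
  | zero => exact absurd hab (Nat.not_lt_zero _)
  | succ b ih =>
    have hstep : μ ⟨b + 1, hb⟩ < μ ⟨b, by lia⟩ :=
      h ⟨b, by lia⟩ (by rw [Fin.lt_def] at hab; simp only at hab hk ⊢; lia)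
    rcases (Nat.lt_succ_iff.1 hab).eq_or_lt with h_eq | h_lt
    · rwa [show a = ⟨b, by lia⟩ from Fin.ext h_eq]
    · exact hstep.trans (ih (by lia) h_lt (by simp only at hk ⊢; lia))

theorem decOnBlocks_of_isMaxInCoset {σ ζ : Perm (Fin n)} (h : IsMaxInCoset k σ ζ) :
    DecOnBlocks k ζ := by
  refine decOnBlocks_of_forall_simple fun i hi => ?_
  obtain ⟨⟨g, hg, hζ⟩, hmax⟩ := h
  have hle := hmax (ζ * simple i)
    ⟨g * simple i, mul_mem (mem_blockSubgroup.2 hg) (simple_mem_blockSubgroup hi),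
      by rw [hζ, mul_assoc]⟩
  refine (lt_or_gt_simple ζ i).resolve_left fun hlt => ?_
  rw [len_mul_simple_of_lt hlt] at hle
  exact Nat.not_succ_le_self _ hle

theorem omega_lt_omega {a b : Fin n} (hab : a < b) : omega n b < omega n a :=
  Fin.rev_lt_rev.2 hab

theorem omega_mul_self : omega n * omega n = 1 :=
  Equiv.ext Fin.rev_rev

theorem isReducedWord_of_append_singleton {u : List (Fin (n - 1))} {i : Fin (n - 1)}
    {g : Perm (Fin n)} (h : IsReducedWord (u ++ [i]) g) :
    IsReducedWord u (g * simple i) ∧ g (rgt i) < g (lft i) := by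
  obtain ⟨rfl, hlen⟩ := h
  rw [wordProd_append_singleton, List.length_append, List.length_singleton] at *
  have hle : len (wordProd u) ≤ u.length := by
    rw [len_eq_inv]
    exact inv_wordProd_le u
  rw [mul_assoc, simple_mul_self, mul_one]
  rcases lt_or_gt_simple (wordProd u) i with h | h
  · refine ⟨⟨rfl, ?_⟩, ?_⟩
    · rw [len_mul_simple_of_lt h] at hlen
      lia
    · rw [simple_eq]
      simpa using h
  · have := len_mul_simple_of_gt h
    lia

theorem succ_ne_of_mem_blockSubgroup {g : Perm (Fin n)} (hg : g ∈ blockSubgroup n k)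
    {i : Fin (n - 1)} (hi : g (rgt i) < g (lft i)) : i.val + 1 ≠ k := by
  have hl := hg (lft i)
  have hr := hg (rgt i)
  rw [Fin.lt_def] at hi
  simp only [lft, rgt] at hl hr hi
  lia

theorem succ_ne_of_mem_of_isReducedWord {g : Perm (Fin n)} (hg : g ∈ blockSubgroup n k)
    {u : List (Fin (n - 1))} (hu : IsReducedWord u g) : ∀ i ∈ u, i.val + 1 ≠ k := by
  induction u using List.reverseRecOn generalizing g with
  | nil => exact fun i hi => absurd hi List.not_mem_nil
  | append_singleton u j ih =>
    obtain ⟨hu', hj⟩ := isReducedWord_of_append_singleton hu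
    have hjk := succ_ne_of_mem_blockSubgroup hg hj
    intro i hi
    rcases List.mem_append.1 hi with hi | hi
    · exact ih (mul_mem hg (simple_mem_blockSubgroup hjk)) hu' i hi
    · rwa [List.mem_singleton.1 hi]

variable {R : Type*} [CommRing R]

theorem foldl_K_of_decOnBlocks {F : (Perm (Fin n) →₀ R) → Fin (n - 1) → Perm (Fin n) →₀ R}
    (hF : ∀ μ i, μ (rgt i) < μ (lft i) → F (K R μ) i = K R (μ * simple i)) {μ g : Perm (Fin n)}
    (hμ : DecOnBlocks k μ) (hg : g ∈ blockSubgroup n k) {u : List (Fin (n - 1))}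
    (hu : IsReducedWord u g) : u.foldl F (K R μ) = K R (μ * g) := by
  induction u using List.reverseRecOn generalizing g with
  | nil => rw [← hu.1]; exact congrArg (K R) (mul_one μ).symm
  | append_singleton u i ih =>
    obtain ⟨hu', hi⟩ := isReducedWord_of_append_singleton hu
    have hik := succ_ne_of_mem_blockSubgroup hg hi
    have hg' := mul_mem hg (simple_mem_blockSubgroup hik)
    have hdesc : (μ * (g * simple i)) (rgt i) < (μ * (g * simple i)) (lft i) := by
      refine hμ ?_ ?_
      · simpa [simple_eq] using hi
      · rw [hg' (lft i), hg' (rgt i)]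
        simp only [lft, rgt]
        lia
    rw [List.foldl_append, ih hg' hu', List.foldl_cons, List.foldl_nil, hF _ _ hdesc, mul_assoc,
      mul_assoc, simple_mul_self, mul_one]

end Words

/-! ### The operators applied to `K_ω` -/

section Action

variable {R : Type*} [CommRing R] {n k : ℕ} {a b p q : Fin n} {μ : Perm (Fin n)}

theorem act_K_factorOp_of_not_isCover (hab : a < b) (h : ¬IsCover μ a b) :
    act (K R μ) (factorOp R a b) = K R μ := by
  rw [factorOp, act_sub, act_one, act_K_transOp hab, if_neg h, sub_zero]

theorem act_K_factorOp_of_isCover (hab : a < b) (h : IsCover μ a b) :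
    act (K R μ) (factorOp R a b) = K R μ - K R (μ * swap a b) := by
  rw [factorOp, act_sub, act_one, act_K_transOp hab, if_pos h]

theorem act_K_rowProd {l : List (Fin n)} (h : ∀ b ∈ l, a < b ∧ μ b < μ a) :
    act (K R μ) (rowProd (factorOp R) a l) = K R μ := by
  induction l with
  | nil => rfl
  | cons b l ih =>
    obtain ⟨⟨hab, hμ⟩, h⟩ := List.forall_mem_cons.1 h
    rw [rowProd_cons, act_mul, act_K_factorOp_of_not_isCover hab fun hc => lt_asymm hc.1 hμ, ih h]

theorem act_K_triangleProd {l : List (Fin n)} (h : l.Pairwise fun a b => a < b ∧ μ b < μ a) :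
    act (K R μ) (triangleProd (factorOp R) l) = K R μ := by
  induction l with
  | nil => rfl
  | cons a l ih =>
    rw [List.pairwise_cons] at h
    rw [triangleProd_cons, act_mul, act_K_rowProd h.1, ih h.2]

theorem act_K_atomOp (hpq : p < q) (h : μ q < μ p) :
    act (K R μ) (atomOp R p q) = K R (μ * swap p q) := by
  rw [atomOp, act_mul, act_K_factorOp_of_not_isCover hpq fun hc => lt_asymm hc.1 h,
    act_K_descentOp, if_pos h]

theorem pi_K_of_gt {i : Fin (n - 1)} (h : μ (rgt i) < μ (lft i)) :
    pi R i (K R μ) = K R (μ * simple i) :=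
  (linearCombination_K _ μ).trans (if_pos h)

theorem pi_K_of_lt {i : Fin (n - 1)} (h : μ (lft i) < μ (rgt i)) : pi R i (K R μ) = K R μ :=
  (linearCombination_K _ μ).trans (if_neg h.not_gt)

theorem op_pi (i : Fin (n - 1)) : MulOpposite.op (pi R i) = piOp R (lft i) (rgt i) := by
  classical
  refine op_ext fun μ => ?_
  have hcov := lft_covBy_rgt i
  change pi R i (K R μ) = _
  rw [piOp, add_mul, one_mul, act_add, act_mul, act_K_transOp hcov.1, act_K_descentOp]
  simp only [isCover_iff_lt_of_covBy hcov]
  rcases lt_or_gt_simple μ i with h | h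
  · rw [pi_K_of_lt h, if_pos h, if_neg h.not_gt, act_K_descentOp, if_pos (by simpa using h),
      mul_assoc, swap_mul_self, mul_one, zero_add]
  · rw [pi_K_of_gt h, if_pos h, if_neg h.not_gt, zero_act, add_zero, simple_eq]

theorem pi_apply_eq_act (x : Perm (Fin n) →₀ R) (i : Fin (n - 1)) :
    pi R i x = act x (piOp R (lft i) (rgt i)) := by
  rw [← op_pi]; rfl

theorem piHat_apply_eq_act (x : Perm (Fin n) →₀ R) (i : Fin (n - 1)) :
    piHat R i x = act x (piOp R (lft i) (rgt i) - 1) := by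
  rw [act_sub, ← pi_apply_eq_act]; rfl

/-- The first `k` positions. -/
def firstPositions (n k : ℕ) : List (Fin n) := (List.finRange n).take k

/-- The positions after the first `k` ones. -/
def lastPositions (n k : ℕ) : List (Fin n) := (List.finRange n).drop k

theorem pairwise_firstPositions : (firstPositions n k).Pairwise (· < ·) :=
  (List.pairwise_lt_finRange n).sublist (List.take_sublist _ _)

theorem pairwise_lastPositions : (lastPositions n k).Pairwise (· < ·) :=
  (List.pairwise_lt_finRange n).sublist (List.drop_sublist _ _)

theorem firstPositions_append_lastPositions :
    firstPositions n k ++ lastPositions n k = List.finRange n :=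
  List.take_append_drop _ _

theorem mem_firstPositions : a ∈ firstPositions n k ↔ a.val < k := by
  rw [firstPositions, List.mem_take_iff_getElem]
  constructor
  · rintro ⟨i, hi, rfl⟩
    simp at hi ⊢
    lia
  · exact fun h => ⟨a.val, by simp [h], by simp⟩

theorem mem_lastPositions : a ∈ lastPositions n k ↔ k ≤ a.val := by
  rw [lastPositions, List.mem_drop_iff_getElem]
  constructor
  · rintro ⟨i, hi, rfl⟩
    simp
  · exact fun h => ⟨a.val - k, by simp; lia, by simp [Nat.add_sub_cancel' h]⟩

theorem lt_of_mem_of_mem (ha : a ∈ firstPositions n k) (hb : b ∈ lastPositions n k) : a < b :=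
  (mem_firstPositions.1 ha).trans_le (mem_lastPositions.1 hb)

theorem act_K_triangleProd_finRange_of_decOnBlocks (hμ : DecOnBlocks k μ) :
    act (K R μ) (triangleProd (factorOp R) (List.finRange n)) =
      act (K R μ) (rectProd (factorOp R) (firstPositions n k) (lastPositions n k).reverse) := by
  have hfirst : (firstPositions n k).Pairwise fun a b => a < b ∧ μ b < μ a :=
    pairwise_firstPositions.imp_of_mem fun ha hb hab =>
      ⟨hab, hμ hab (iff_of_true (mem_firstPositions.1 ha) (mem_firstPositions.1 hb))⟩
  have hlast : (lastPositions n k).Pairwise fun a b => a < b ∧ μ b < μ a :=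
    pairwise_lastPositions.imp_of_mem fun ha hb hab =>
      ⟨hab, hμ hab <|
        iff_of_false (mem_lastPositions.1 ha).not_gt (mem_lastPositions.1 hb).not_gt⟩
  have hpos : (firstPositions n k ++ lastPositions n k).Pairwise (· < ·) := by
    rw [firstPositions_append_lastPositions]
    exact List.pairwise_lt_finRange n
  rw [← firstPositions_append_lastPositions (k := k),
    isYangBaxter_factorOp.triangleProd_append hpos, act_mul, act_mul, act_K_triangleProd hfirst,
    act_K_triangleProd hlast]

theorem semiconjBy_triangleProd_finRange (hpq : p ⋖ q) :
    SemiconjBy (triangleProd (factorOp R) (List.finRange n)) (piOp R p q - 1) (atomOp R p q) := by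
  have hpos := List.pairwise_lt_finRange n
  obtain ⟨l₁, l₂, hl⟩ := exists_eq_append_cons_cons_of_covBy hpos hpq (List.mem_finRange p)
    (List.mem_finRange q)
  rw [hl] at hpos ⊢
  exact semiconjBy_triangleProd_piOp_sub_one hpq hpos

theorem commute_piOp_rectProd (hpq : p ⋖ q) (h : p.val < k ↔ q.val < k) :
    Commute (piOp R p q)
      (rectProd (factorOp R) (firstPositions n k) (lastPositions n k).reverse) := by
  have hlt : ∀ a ∈ firstPositions n k, ∀ b ∈ (lastPositions n k).reverse, a < b :=
    fun a ha b hb => lt_of_mem_of_mem ha (List.mem_reverse.1 hb)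
  have hfirst := pairwise_firstPositions (n := n) (k := k)
  have hlast := pairwise_lastPositions (n := n) (k := k)
  have hnd : (lastPositions n k).reverse.Nodup := List.nodup_reverse.2 hlast.nodup
  by_cases hp : p.val < k
  · obtain ⟨l₁, l₂, hl⟩ := exists_eq_append_cons_cons_of_covBy hfirst hpq
      (mem_firstPositions.2 hp) (mem_firstPositions.2 (h.1 hp))
    rw [hl] at hlt hfirst ⊢
    exact commute_piOp_rectProd_left hpq hfirst.nodup hnd hlt
  · obtain ⟨l₁, l₂, hl⟩ := exists_eq_append_cons_cons_of_covBy hlast hpq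
      (mem_lastPositions.2 (not_lt.1 hp)) (mem_lastPositions.2 (not_lt.1 (mt h.2 hp)))
    have hrev : (lastPositions n k).reverse = l₂.reverse ++ q :: p :: l₁.reverse := by
      rw [hl, List.reverse_append, List.reverse_cons, List.reverse_cons, List.append_assoc,
        List.append_assoc, List.singleton_append, List.singleton_append]
    rw [hrev] at hlt hnd ⊢
    exact commute_piOp_rectProd_right hpq hnd hlt

theorem piHatWord_K_omega {ζ : Perm (Fin n)} {u : List (Fin (n - 1))}
    (hu : IsReducedWord u (omega n * ζ)) :
    piHatWord (K R (omega n)) u =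
      act (K R ζ) (triangleProd (factorOp R) (List.finRange n)) := by
  set F := triangleProd (factorOp R) (List.finRange n)
  let atom (x : Perm (Fin n) →₀ R) (i : Fin (n - 1)) := act x (atomOp R (lft i) (rgt i))
  have hmove : ∀ x i, piHat R i (act x F) = act (atom x i) F := fun x i => by
    rw [piHat_apply_eq_act, ← act_mul, (semiconjBy_triangleProd_finRange (lft_covBy_rgt i)).eq,
      act_mul]
  have hω : DecOnBlocks 0 (omega n) := fun _ _ hab _ => omega_lt_omega hab
  calc piHatWord (K R (omega n)) u
      = piHatWord (act (K R (omega n)) F) u := by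
        rw [act_K_triangleProd ((List.pairwise_lt_finRange n).imp fun hab =>
          ⟨hab, omega_lt_omega hab⟩)]
    _ = act (u.foldl atom (K R (omega n))) F := List.foldl_hom (act · F) hmove
    _ = act (K R ζ) F := by
        rw [foldl_K_of_decOnBlocks (fun μ i => act_K_atomOp (lft_covBy_rgt i).1) hω
          (mem_blockSubgroup.2 fun i => by simp) hu, ← mul_assoc, omega_mul_self, one_mul]

theorem piWord_K_rectProd {ζ g : Perm (Fin n)} (hζ : DecOnBlocks k ζ) (hg : g ∈ blockSubgroup n k)
    {v : List (Fin (n - 1))} (hv : IsReducedWord v g) :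
    piWord (act (K R ζ) (rectProd (factorOp R) (firstPositions n k) (lastPositions n k).reverse))
        v =
      act (K R (ζ * g))
        (rectProd (factorOp R) (firstPositions n k) (lastPositions n k).reverse) := by
  set F := rectProd (factorOp R) (firstPositions n k) (lastPositions n k).reverse
  have hmove : ∀ i ∈ v, ∀ x y : Perm (Fin n) →₀ R, x = act y F → pi R i x = act (pi R i y) F := by
    rintro i hi x y rfl
    have hik := succ_ne_of_mem_of_isReducedWord hg hv i hi
    have hcomm : Commute (piOp R (lft i) (rgt i)) F :=
      commute_piOp_rectProd (lft_covBy_rgt i) (by simp only [lft, rgt]; lia)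
    rw [pi_apply_eq_act, pi_apply_eq_act, ← act_mul, ← hcomm.eq, act_mul]
  calc piWord (act (K R ζ) F) v
      = act (piWord (K R ζ) v) F := List.foldl_rel (r := fun x y => x = act y F) rfl hmove
    _ = act (K R (ζ * g)) F := by
        rw [piWord, foldl_K_of_decOnBlocks (fun μ i => pi_K_of_gt) hζ hg hv]

theorem piWord_piHatWord_K_omega {σ ζ : Perm (Fin n)} (hζ : IsMaxInCoset k σ ζ)
    {u v : List (Fin (n - 1))} (hu : IsReducedWord u (omega n * ζ))
    (hv : IsReducedWord v (ζ⁻¹ * σ)) :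
    piWord (piHatWord (K R (omega n)) u) v =
      act (K R σ) (rectProd (factorOp R) (firstPositions n k) (lastPositions n k).reverse) := by
  have hdec := decOnBlocks_of_isMaxInCoset hζ
  obtain ⟨g, hg, hζσ⟩ := hζ.1
  have hmem : ζ⁻¹ * σ ∈ blockSubgroup n k := by
    rw [hζσ, mul_inv_rev, inv_mul_cancel_right]
    exact inv_mem (mem_blockSubgroup.2 hg)
  rw [piHatWord_K_omega hu, act_K_triangleProd_finRange_of_decOnBlocks hdec,
    piWord_K_rectProd hdec hmem hv, mul_inv_cancel_left]

end Action

/-! ### From the rectangle to `W k σ` -/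

section Letters

theorem list_prod_eq_of_perm {M α : Type*} [Monoid M] {f : α → M} {r s : α → α → Prop}
    {l l' : List α} (h : ∀ x ∈ l, ∀ y ∈ l, r x y → s y x → Commute (f x) (f y))
    (hperm : l.Perm l') (hl : l.Pairwise r) (hl' : l'.Pairwise s) :
    (l.map f).prod = (l'.map f).prod := by
  induction l generalizing l' with
  | nil => rw [List.nil_perm.1 hperm]
  | cons x t ih =>
    obtain ⟨l₁, l₂, rfl⟩ := List.append_of_mem (hperm.subset List.mem_cons_self)
    have ht : t.Perm (l₁ ++ l₂) := (List.perm_cons x).1 (hperm.trans List.perm_middle)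
    obtain ⟨hx, hl⟩ := List.pairwise_cons.1 hl
    have hcomm : Commute (f x) (l₁.map f).prod := by
      refine Commute.list_prod_right _ _ (List.forall_mem_map.2 fun y hy => ?_)
      have hyt : y ∈ t := ht.symm.subset (List.mem_append_left _ hy)
      exact h x List.mem_cons_self y (List.mem_cons_of_mem _ hyt) (hx y hyt)
        ((List.pairwise_append.1 hl').2.2 y hy x List.mem_cons_self)
    rw [List.map_cons, List.prod_cons,
      ih (fun y hy z hz => h y (List.mem_cons_of_mem _ hy) z (List.mem_cons_of_mem _ hz)) ht hl
        (hl'.sublist (List.Sublist.append_left (List.sublist_cons_self x l₂) l₁))]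
    simp only [List.map_append, List.map_cons, List.prod_append, List.prod_cons]
    rw [← mul_assoc, hcomm.eq, mul_assoc]

/-- The order in which `rectProd r S T.reverse` multiplies its letters when `S` and `T` are
increasing: rows from top to bottom, each row from right to left. -/
def RowBefore {ι : Type*} [LT ι] (p q : ι × ι) : Prop :=
  p.1 < q.1 ∨ p.1 = q.1 ∧ q.2 < p.2

theorem RowBefore.ne {ι : Type*} [Preorder ι] {p q : ι × ι} (h : RowBefore p q) : p ≠ q := by
  rintro rfl
  exact h.elim (lt_irrefl _) fun h => lt_irrefl _ h.2

theorem pairwise_product_reverse {ι : Type*} [LT ι] {S T : List ι} (hS : S.Pairwise (· < ·))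
    (hT : T.Pairwise (· < ·)) : (S ×ˢ T.reverse).Pairwise RowBefore := by
  induction S with
  | nil => exact List.Pairwise.nil
  | cons a S ih =>
    obtain ⟨ha, hS⟩ := List.pairwise_cons.1 hS
    rw [List.product_cons, List.pairwise_append, List.pairwise_map]
    refine ⟨(List.pairwise_reverse.2 hT).imp fun h => Or.inr ⟨rfl, h⟩, ih hS, ?_⟩
    rintro _ hp q hq
    obtain ⟨b, -, rfl⟩ := List.mem_map.1 hp
    exact Or.inl (ha q.1 (List.mem_product.1 hq).1)

variable {R : Type*} [CommRing R] {n k : ℕ} {μ σ : Perm (Fin n)} {τ θ : Fin n × Fin n}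

theorem act_K_list_prod_filter {P : Fin n × Fin n → Bool} {l : List (Fin n × Fin n)}
    (hl : l.Pairwise RowBefore) (hlt : ∀ p ∈ l, ∀ q ∈ l, p.1 < q.2)
    (hP : ∀ p ∈ l, IsCover μ p.1 p.2 → P p) :
    act (K R μ) (l.map fun p => factorOp R p.1 p.2).prod =
      act (K R μ) ((l.filter P).map fun p => factorOp R p.1 p.2).prod := by
  induction l generalizing μ with
  | nil => rfl
  | cons p t ih =>
    obtain ⟨hp, ht⟩ := List.pairwise_cons.1 hl
    obtain ⟨hPp, hPt⟩ := List.forall_mem_cons.1 hP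
    have hp' : p.1 < p.2 := hlt p List.mem_cons_self p List.mem_cons_self
    have hlt' : ∀ q ∈ t, ∀ q' ∈ t, q.1 < q'.2 := fun q hq q' hq' =>
      hlt q (List.mem_cons_of_mem _ hq) q' (List.mem_cons_of_mem _ hq')
    have hμ := ih ht hlt' hPt
    rw [List.map_cons, List.prod_cons, act_mul]
    by_cases hcover : IsCover μ p.1 p.2
    · have hswap := ih (μ := μ * swap p.1 p.2) ht hlt' fun q hq hq_cover => hPt q hq <|
        isCover_of_isCover_mul_swap (hlt' q hq q hq) hp'
          (hlt q (List.mem_cons_of_mem _ hq) p List.mem_cons_self)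
          (hlt p List.mem_cons_self q (List.mem_cons_of_mem _ hq)) (hp q hq) hcover hq_cover
      rw [List.filter_cons_of_pos (hPp hcover), List.map_cons, List.prod_cons, act_mul,
        act_K_factorOp_of_isCover hp' hcover, sub_act, sub_act, hμ, hswap]
    · rw [act_K_factorOp_of_not_isCover hp' hcover, hμ, List.filter_cons]
      split_ifs
      · rw [List.map_cons, List.prod_cons, act_mul, act_K_factorOp_of_not_isCover hp' hcover]
      · rfl

theorem mem_W : τ ∈ W k σ ↔ IsKBruhat k σ τ := by
  simp [W]

theorem pairwise_W : (W k σ).Pairwise (Prec σ) :=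
  Finset.pairwise_sort _ _

theorem nodup_W : (W k σ).Nodup :=
  Finset.sort_nodup _ _

theorem IsKBruhat.fst_lt_snd (hτ : IsKBruhat k σ τ) (hθ : IsKBruhat k μ θ) : τ.1 < θ.2 :=
  Fin.lt_def.2 (hτ.1.trans_le hθ.2.1)

theorem IsKBruhat.isCover (h : IsKBruhat k σ τ) : IsCover σ τ.1 τ.2 :=
  (isBruhat_iff_isCover (h.fst_lt_snd h)).1 h.2.2

theorem IsKBruhat.snd_lt_snd_of_prec {a b d : Fin n} (hb : IsKBruhat k σ (a, b))
    (hd : IsKBruhat k σ (a, d)) (hprec : Prec σ (a, d) (a, b)) (hdb : d ≠ b) : b < d :=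
  hb.isCover.right_lt_right (hb.fst_lt_snd hd) hd.isCover.1
    ((hprec.resolve_left (lt_irrefl _)).2.lt_of_ne (σ.injective.ne hdb))

theorem commute_factorOp_of_rowBefore_of_prec (hτ : IsKBruhat k σ τ) (hθ : IsKBruhat k σ θ)
    (h : RowBefore τ θ) (hprec : Prec σ θ τ) :
    Commute (factorOp R τ.1 τ.2) (factorOp R θ.1 θ.2) := by
  obtain ⟨a, b⟩ := τ
  obtain ⟨c, d⟩ := θ
  have hab : a < b := hτ.fst_lt_snd hτ
  have hcd : c < d := hθ.fst_lt_snd hθ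
  have had : a < d := hτ.fst_lt_snd hθ
  have hcb : c < b := hθ.fst_lt_snd hτ
  have hac : a < c := by
    refine h.resolve_right ?_
    rintro ⟨rfl, hdb⟩
    exact lt_asymm hdb (hτ.snd_lt_snd_of_prec hθ hprec hdb.ne)
  have hσ : σ a < σ c := hprec.resolve_right fun h => hac.ne' h.1
  have hbd : b ≠ d := by
    rintro rfl
    exact lt_asymm hac (hτ.isCover.left_lt_left hcb hσ hθ.isCover.1)
  exact isYangBaxter_factorOp.commute hab hcd hac.ne had.ne hcb.ne' hbd

theorem foldl_actT (l : List (Fin n × Fin n)) (x : Perm (Fin n) →₀ R) :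
    l.foldl (fun x τ => x - actT R τ x) x =
      act x (l.map fun τ => factorOp R τ.1 τ.2).prod := by
  induction l generalizing x with
  | nil => rfl
  | cons τ l ih =>
    rw [List.foldl_cons, ih, List.map_cons, List.prod_cons, act_mul]
    rfl

theorem act_K_rectProd_eq_E :
    act (K R σ) (rectProd (factorOp R) (firstPositions n k) (lastPositions n k).reverse) =
      E R k σ := by
  classical
  set l := firstPositions n k ×ˢ (lastPositions n k).reverse with hl_def
  have hmem : ∀ p, p ∈ l ↔ p.1.val < k ∧ k ≤ p.2.val := fun p => by
    rw [hl_def, List.mem_product, List.mem_reverse, mem_firstPositions, mem_lastPositions]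
  have hlt : ∀ p ∈ l, ∀ q ∈ l, p.1 < q.2 := fun p hp q hq =>
    Fin.lt_def.2 (((hmem p).1 hp).1.trans_le ((hmem q).1 hq).2)
  have hl : l.Pairwise RowBefore :=
    pairwise_product_reverse pairwise_firstPositions pairwise_lastPositions
  have hcover : ∀ p ∈ l, IsCover σ p.1 p.2 → decide (p ∈ W k σ) := fun p hp h =>
    decide_eq_true <| mem_W.2
      ⟨((hmem p).1 hp).1, ((hmem p).1 hp).2, (isBruhat_iff_isCover (hlt p hp p hp)).2 h⟩
  have hperm : (l.filter (· ∈ W k σ)).Perm (W k σ) := by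
    refine (List.perm_ext_iff_of_nodup ((hl.imp RowBefore.ne).filter _) nodup_W).2 fun p => ?_
    rw [List.mem_filter, decide_eq_true_iff, and_iff_right_iff_imp]
    exact fun hp => (hmem p).2 ⟨(mem_W.1 hp).1, (mem_W.1 hp).2.1⟩
  rw [E, foldl_actT, rectProd, act_K_list_prod_filter hl hlt hcover]
  refine congrArg (act _) <|
    list_prod_eq_of_perm (fun p hp q hq => ?_) hperm (hl.filter _) pairwise_W
  exact commute_factorOp_of_rowBefore_of_prec (mem_W.1 (hperm.subset hp))
    (mem_W.1 (hperm.subset hq))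

end Letters

/-! ### Valid subwords -/

section ValidSubwords

variable {R : Type*} [CommRing R] {n k : ℕ} {μ σ : Perm (Fin n)} {a : Fin n}
  {w w' : List (Fin n × Fin n)} {τ τ' : Fin n × Fin n}

theorem isValid_append_singleton :
    IsValid μ (w ++ [τ]) ↔ IsValid μ w ∧ IsBruhat (endpoint μ w) τ := by
  induction w generalizing μ with
  | nil => exact and_comm
  | cons θ w ih => exact (and_congr_right fun _ => ih).trans and_assoc.symm

theorem endpoint_append_singleton :
    endpoint μ (w ++ [τ]) = endpoint μ w * swap τ.1 τ.2 :=
  List.foldl_append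

theorem mem_validSubwords : w ∈ validSubwords k σ ↔ w.Sublist (W k σ) ∧ IsValid σ w := by
  classical
  rw [validSubwords, Finset.mem_filter, List.mem_toFinset, List.mem_sublists]

theorem isKBruhat_of_mem_of_mem_validSubwords (hw : w ∈ validSubwords k σ) (hτ : τ ∈ w) :
    IsKBruhat k σ τ :=
  mem_W.1 ((mem_validSubwords.1 hw).1.subset hτ)

theorem prec_of_append_singleton_mem_validSubwords (hw : w ++ [τ] ∈ validSubwords k σ)
    (hτ' : τ' ∈ w) : Prec σ τ' τ :=
  (List.pairwise_append.1 (pairwise_W.sublist (mem_validSubwords.1 hw).1)).2.2 τ' hτ' τ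
    List.mem_cons_self

theorem mem_validSubwords_of_append_singleton (hw : w ++ [τ] ∈ validSubwords k σ) :
    w ∈ validSubwords k σ :=
  have ⟨hsub, hvalid⟩ := mem_validSubwords.1 hw
  mem_validSubwords.2
    ⟨(List.sublist_append_left w [τ]).trans hsub, (isValid_append_singleton.1 hvalid).1⟩

theorem isCover_endpoint_of_append_singleton (hw : w ++ [τ] ∈ validSubwords k σ) :
    IsCover (endpoint σ w) τ.1 τ.2 := by
  have hτ := isKBruhat_of_mem_of_mem_validSubwords hw (List.mem_concat_self)
  exact (isBruhat_iff_isCover (hτ.fst_lt_snd hτ)).1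
    (isValid_append_singleton.1 (mem_validSubwords.1 hw).2).2

theorem len_endpoint (h : IsValid μ w) : len (endpoint μ w) = len μ + w.length := by
  induction w generalizing μ with
  | nil => rfl
  | cons τ w ih =>
    obtain ⟨hτ, hw⟩ := h
    calc len (endpoint μ (τ :: w)) = len (mulT μ τ) + w.length := ih hw
      _ = len μ + (τ :: w).length := by rw [hτ, List.length_cons, add_right_comm, add_assoc]

theorem endpoint_apply_of_forall_lt (hw : ∀ τ ∈ w, IsKBruhat k σ τ) (ha : a.val < k)
    (h : ∀ τ ∈ w, σ a < σ τ.1) : endpoint σ w a = σ a := by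
  induction w using List.reverseRecOn with
  | nil => rfl
  | append_singleton w τ ih =>
    rw [List.forall_mem_append, List.forall_mem_singleton] at hw h
    have ha₁ : a ≠ τ.1 := ne_of_apply_ne σ h.2.ne
    have ha₂ : a ≠ τ.2 := ne_of_apply_ne Fin.val (ha.trans_le hw.2.2.1).ne
    rw [endpoint_append_singleton, Perm.mul_apply, swap_apply_of_ne_of_ne ha₁ ha₂, ih hw.1 h.1]

theorem le_endpoint_apply (hw : w ∈ validSubwords k σ) (ha : a.val < k) :
    σ a ≤ endpoint σ w a := by
  induction w using List.reverseRecOn with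
  | nil => exact le_rfl
  | append_singleton w τ ih =>
    have hle := ih (mem_validSubwords_of_append_singleton hw)
    have hτ := isKBruhat_of_mem_of_mem_validSubwords hw List.mem_concat_self
    have ha₂ : a ≠ τ.2 := ne_of_apply_ne Fin.val (ha.trans_le hτ.2.1).ne
    rw [endpoint_append_singleton, Perm.mul_apply]
    rcases eq_or_ne a τ.1 with rfl | ha₁
    · rw [swap_apply_left]
      exact hle.trans (isCover_endpoint_of_append_singleton hw).1.le
    · rwa [swap_apply_of_ne_of_ne ha₁ ha₂]

theorem endpoint_apply_fst_le_endpoint_apply_snd (hw : w ∈ validSubwords k σ)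
    (hτ : IsKBruhat k σ τ) (hprec : ∀ θ ∈ w, Prec σ θ τ) (hτw : τ ∉ w)
    (h : σ τ.1 ≤ endpoint σ w τ.2) : endpoint σ w τ.1 ≤ endpoint σ w τ.2 := by
  obtain ⟨a, b⟩ := τ
  induction w using List.reverseRecOn with
  | nil => exact h
  | append_singleton w θ ih =>
    obtain ⟨c, d⟩ := θ
    have hk := fun τ => isKBruhat_of_mem_of_mem_validSubwords (τ := τ) hw
    have hcd : IsKBruhat k σ (c, d) := hk _ List.mem_concat_self
    have hcover : IsCover (endpoint σ w) c d := isCover_endpoint_of_append_singleton hw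
    obtain ⟨hprec_w, hprec_cd⟩ := List.forall_mem_append.1 hprec
    have hcd_ab := hprec_cd _ List.mem_cons_self
    rw [List.mem_append, List.mem_singleton, not_or] at hτw
    rcases eq_or_ne c a with rfl | hca
    · have hab : c < b := hτ.fst_lt_snd hτ
      have hdb : d ≠ b := fun h => hτw.2 (h ▸ rfl)
      have hbd : b < d := hτ.snd_lt_snd_of_prec hcd hcd_ab hdb
      rw [endpoint_append_singleton] at h ⊢
      simp only [Perm.mul_apply, swap_apply_left, swap_apply_of_ne_of_ne hab.ne' hbd.ne] at h ⊢
      have hle := ih (mem_validSubwords_of_append_singleton hw) hprec_w hτw.1 h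
      exact (hcover.2 b hab hbd).elim (fun h => absurd hle h.not_ge) le_of_lt
    · have hσ : σ a < σ c := hcd_ab.resolve_right fun h => hca h.1
      have hlt : ∀ θ ∈ w ++ [(c, d)], σ a < σ θ.1 := by
        refine List.forall_mem_append.2 ⟨fun θ hθ => ?_, List.forall_mem_singleton.2 hσ⟩
        rcases prec_of_append_singleton_mem_validSubwords hw hθ with h | ⟨h, -⟩
        · exact hσ.trans h
        · rwa [h]
      rwa [endpoint_apply_of_forall_lt hk hτ.1 hlt]

theorem endpoint_append_singleton_ne (hw : w ++ [τ] ∈ validSubwords k σ)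
    (hw' : w' ∈ validSubwords k σ) (hprec : ∀ θ ∈ w', Prec σ θ τ) (hτ : τ ∉ w') :
    endpoint σ (w ++ [τ]) ≠ endpoint σ w' := by
  intro h
  have hτk := isKBruhat_of_mem_of_mem_validSubwords hw List.mem_concat_self
  have hfst : endpoint σ w' τ.1 = endpoint σ w τ.2 := by
    rw [← h, endpoint_append_singleton, Perm.mul_apply, swap_apply_left]
  have hsnd : endpoint σ w' τ.2 = endpoint σ w τ.1 := by
    rw [← h, endpoint_append_singleton, Perm.mul_apply, swap_apply_right]
  have hle : σ τ.1 ≤ endpoint σ w τ.1 :=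
    le_endpoint_apply (mem_validSubwords_of_append_singleton hw) hτk.1
  have hge := endpoint_apply_fst_le_endpoint_apply_snd hw' hτk hprec hτ (hsnd ▸ hle)
  rw [hfst, hsnd] at hge
  exact hge.not_gt (isCover_endpoint_of_append_singleton hw).1

theorem endpoint_append_singleton_ne_of_prec (hw : w ++ [τ] ∈ validSubwords k σ)
    (hw' : w' ++ [τ'] ∈ validSubwords k σ) (hprec : Prec σ τ' τ) (hne : τ' ≠ τ) :
    endpoint σ (w ++ [τ]) ≠ endpoint σ (w' ++ [τ']) := by
  have hw'τ' := fun θ => prec_of_append_singleton_mem_validSubwords (τ' := θ) hw'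
  refine endpoint_append_singleton_ne hw hw'
    (List.forall_mem_append.2
      ⟨fun θ hθ => _root_.trans (hw'τ' θ hθ) hprec, List.forall_mem_singleton.2 hprec⟩) ?_
  rw [List.mem_append, List.mem_singleton, not_or]
  exact ⟨fun h => hne (antisymm hprec (hw'τ' τ h)), hne.symm⟩

theorem endpoint_injOn_validSubwords : Set.InjOn (endpoint σ) (validSubwords k σ) := by
  intro w hw w' hw' h
  rw [Finset.mem_coe] at hw hw'
  induction w using List.reverseRecOn generalizing w' with
  | nil =>
    rcases List.eq_nil_or_concat' w' with rfl | ⟨w', τ', rfl⟩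
    · rfl
    · exact absurd h.symm (endpoint_append_singleton_ne hw' hw (by simp) (by simp))
  | append_singleton w τ ih =>
    rcases List.eq_nil_or_concat' w' with rfl | ⟨w', τ', rfl⟩
    · exact absurd h (endpoint_append_singleton_ne hw hw' (by simp) (by simp))
    rcases eq_or_ne τ τ' with rfl | hne
    · rw [endpoint_append_singleton, endpoint_append_singleton, mul_left_inj] at h
      rw [ih (mem_validSubwords_of_append_singleton hw)
        (mem_validSubwords_of_append_singleton hw') h]
    · rcases total_of (Prec σ) τ τ' with hprec | hprec
      · exact absurd h.symm (endpoint_append_singleton_ne_of_prec hw' hw hprec hne)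
      · exact absurd h (endpoint_append_singleton_ne_of_prec hw hw' hprec hne.symm)

open Classical in
theorem act_K_list_prod_factorOp (l : List (Fin n × Fin n)) :
    act (K R μ) (l.map fun τ => factorOp R τ.1 τ.2).prod =
      (l.sublists'.map fun w =>
        if IsValid μ w then (-1 : R) ^ w.length • K R (endpoint μ w) else 0).sum := by
  induction l generalizing μ with
  | nil => simp [IsValid, endpoint, act_one]
  | cons τ l ih =>
    have hτ : act (K R μ) (factorOp R τ.1 τ.2) =
        K R μ - if IsBruhat μ τ then K R (mulT μ τ) else 0 :=
      congrArg (K R μ - ·) (linearCombination_K _ μ)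
    rw [List.map_cons, List.prod_cons, act_mul, hτ, sub_act, ih, List.sublists'_cons,
      List.map_append, List.sum_append, List.map_map, sub_eq_add_neg]
    congr 1
    split_ifs with h
    · rw [ih, ← neg_one_smul R, List.smul_sum, List.map_map]
      congr 2
      funext w
      simp only [Function.comp, IsValid, endpoint, List.foldl_cons, h, true_and, smul_ite,
        smul_zero, smul_smul, List.length_cons, pow_succ']
    · rw [zero_act, neg_zero]
      refine (List.sum_eq_zero (List.forall_mem_map.2 fun w _ => ?_)).symm
      exact if_neg fun hw => h hw.1

theorem E_eq_sum :
    E R k σ = ∑ w ∈ validSubwords k σ, (-1 : R) ^ w.length • K R (endpoint σ w) := by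
  classical
  rw [E, foldl_actT, act_K_list_prod_factorOp, validSubwords, Finset.sum_filter,
    List.sum_toFinset _ (List.nodup_sublists.2 nodup_W)]
  exact ((List.sublists_perm_sublists' _).map _).sum_eq.symm

theorem E_apply_endpoint (hw : w ∈ validSubwords k σ) :
    E R k σ (endpoint σ w) = (-1 : R) ^ w.length := by
  rw [E_eq_sum, Finsupp.finsetSum_apply, Finset.sum_eq_single_of_mem w hw]
  · simp [K]
  · intro w' hw' hne
    simp [K, endpoint_injOn_validSubwords.ne hw' hw hne]

theorem E_apply_of_forall_endpoint_ne (hμ : ∀ w ∈ validSubwords k σ, endpoint σ w ≠ μ) :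
    E R k σ μ = 0 := by
  rw [E_eq_sum, Finsupp.finsetSum_apply]
  refine Finset.sum_eq_zero fun w hw => ?_
  simp [K, hμ w hw]

end ValidSubwords

end ZeroHecke

theorem proposition4p2p2 (R : Type*) [CommRing R] (n k : ℕ) (hk : 1 ≤ k) (hkn : k < n)
    (σ ζ : Equiv.Perm (Fin n)) (hζ : IsMaxInCoset k σ ζ) :
    (∀ u v : List (Fin (n - 1)),
      IsReducedWord u (omega n * ζ) → IsReducedWord v (ζ⁻¹ * σ) →
        piWord (piHatWord (K R (omega n)) u) v = E R k σ) ∧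
    E R k σ = ∑ w ∈ validSubwords k σ, (-1 : R) ^ w.length • K R (endpoint σ w) ∧
    (∀ w ∈ validSubwords k σ, ∀ w' ∈ validSubwords k σ,
      endpoint σ w = endpoint σ w' → w = w') ∧
    (∀ w ∈ validSubwords k σ, len σ ≤ len (endpoint σ w) ∧
      E R k σ (endpoint σ w) = (-1 : R) ^ (len (endpoint σ w) - len σ)) ∧
    (∀ μ : Equiv.Perm (Fin n), (∀ w ∈ validSubwords k σ, endpoint σ w ≠ μ) →
      E R k σ μ = 0) := by
  refine ⟨fun u v hu hv => (piWord_piHatWord_K_omega hζ hu hv).trans act_K_rectProd_eq_E, E_eq_sum,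
    fun w hw w' hw' h => endpoint_injOn_validSubwords hw hw' h, fun w hw => ?_,
    fun μ hμ => E_apply_of_forall_endpoint_ne hμ⟩
  have hlen := len_endpoint (mem_validSubwords.1 hw).2
  exact ⟨hlen ▸ Nat.le_add_right _ _, by rw [hlen, Nat.add_sub_cancel_left, E_apply_endpoint hw]⟩
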